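/- **Setting.** Consider first-order linear-time temporal logic (time $\mathbb N$, one non-empty domain for all moments, flexible predicates, rigid constants) over a language with predicate symbols and constants, without equality and without function symbols. A *literal* is an atom or its negation; $\bot,\models$ and validity refer to classical first-order logic. A *monodic temporal problem in divided separated normal form* is a quadruple $\mathsf P=\langle\mathcal U,\mathcal I,\mathcal S,\mathcal E\rangle$ of finite sets: $\mathcal U$ and $\mathcal I$ consist of closed first-order formulas; $\mathcal S$ of step clauses $l\Rightarrow\bigcirc m$ (ground) and $L(x)\Rightarrow\bigcirc M(x)$ (non-ground), no two different ones having the same left-hand side; $\mathcal E$ of eventualities $\Diamond l$ (ground) and $\Diamond L(x)$ (non-ground). Here $l,m$ are propositional and $L(x),M(x)$ unary literals. $\mathsf P$ is *(un)satisfiable* if $\mathcal I\wedge\Box\,\mathcal U\wedge\Box\forall x\,\mathcal S\wedge\Box\forall x\,\mathcal E$ is. Let $\mathrm{const}(\mathsf P)$ be the set of constants occurring in $\mathsf P$. The *constant flooded form* is $\mathsf P^c=\mathsf P\cup\{\Diamond L(c)\mid \Diamond L(x)\in\mathcal E,\ c\in\mathrm{const}(\mathsf P)\}$, where the $\Diamond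 L(c)$ count as ground eventualities $\Diamond l$ (with $l=L(c)$). **Clauses.** For non-ground step clauses $P_1(x)\Rightarrow\bigcirc M_1(x),\dots,P_k(x)\Rightarrow\bigcirc M_k(x)$ in $\mathcal S$ ($k\ge1$), the *derived step clauses* are $$\forall x\textstyle\bigvee_jP_j(x)\Rightarrow\bigcirc\forall x\bigvee_jM_j(x),\qquad \exists x\textstyle\bigwedge_jP_j(x)\Rightarrow\bigcirc\exists x\bigwedge_jM_j(x),\qquad P_j(c)\Rightarrow\bigcirc M_j(c)\ \ (c\in\mathrm{const}(\mathsf P)).$$ A *merged derived step clause* $\mathcal A\Rightarrow\bigcirc\mathcal B$ is $\bigwedge_{i=1}^n\Phi_i\Rightarrow\bigcirc\bigwedge_{i=1}^n\Psi_i$, where $n\ge1$ and each $\Phi_i\Rightarrow\bigcirc\Psi_i$ is a derived step clause or a ground step clause of $\mathcal S$. A *full merged step clause* is $\forall x(\mathcal A\wedge A(x)\Rightarrow\bigcirc(\mathcal B\wedge B(x)))$, where $\mathcal A\Rightarrow\bigcirc\mathcal B$ is a merged derived step clause, $A(x)=\bigwedge_{i=1}^kP_i(x)$ and $B(x)=\bigwedge_{i=1}^kM_i(x)$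 for non-ground step clauses $P_i(x)\Rightarrow\bigcirc M_i(x)$ in $\mathcal S$ ($k\ge0$). **Rules** (with respect to the current universal part $\mathcal U$). * *Step resolution:* from $\mathcal A\Rightarrow\bigcirc\mathcal B$ with $\mathcal U\cup\{\mathcal B\}\models\bot$ infer $\neg\mathcal A$. * *Eventuality resolution:* from $\Diamond L(x)\in\mathcal E$ and full merged step clauses $\forall x(\mathcal A_i\wedge A_i(x)\Rightarrow\bigcirc(\mathcal B_i\wedge B_i(x)))$, $i=1,\dots,n$, such that for all $i$ the formulas $\forall x(\mathcal U\wedge\mathcal B_i\wedge B_i(x)\Rightarrow\neg L(x))$ and $\forall x(\mathcal U\wedge\mathcal B_i\wedge B_i(x)\Rightarrow\bigvee_{j=1}^n(\mathcal A_j\wedge A_j(x)))$ are valid, infer $\forall x\bigwedge_{i=1}^n(\neg\mathcal A_i\vee\neg A_i(x))$. * *Ground eventuality resolution:* from $\Diamond l\in\mathcal E$ and merged derived step clauses $\mathcal A_i\Rightarrow\bigcirc\mathcal B_i$, $i=1,\dots,n$, such that $\mathcal U\wedge\mathcal B_i\models\neg l$ and $\mathcal U\wedge\mathcal B_i\models\bigvee_{j=1}^n\mathcal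 A_j$ for all $i$, infer $\bigwedge_{i=1}^n\neg\mathcal A_i$. * *Termination rules:* the derivation terminates successfully if $\mathcal U\cup\mathcal I\models\bot$ (initial), or $\mathcal U\models\forall x\,\neg L(x)$ for some $\Diamond L(x)\in\mathcal E$ (eventuality), or $\mathcal U\models\neg l$ for some $\Diamond l\in\mathcal E$ (ground eventuality). A *derivation* is a finite sequence of universal parts $\mathcal U=\mathcal U_0\subseteq\mathcal U_1\subseteq\dots\subseteq\mathcal U_k$ in which each $\mathcal U_{i+1}$ is $\mathcal U_i$ together with the conclusion of one of the three resolution rules with respect to $\mathcal U_i$ ($\mathcal I,\mathcal S,\mathcal E$ do not change); it is *successfully terminating* if a termination rule applies with respect to $\mathcal U_k$. **Theorem (Completeness of Temporal Resolution).** Let a monodic temporal problem $\mathsf P$ in divided separated normal form be unsatisfiable. Then there is a successfully terminating derivation from $\mathsf P^c$. The same holds if, to stay within the normal form, the added eventualities $\Diamond L(c)$ of $\mathsf P^c$ are renamed by propositions, that is, if instead of each $\Diamond L(c)$ an eventuality $\Diamond q_{L,c}$ and a universal formula $q_{L,c}\Rightarrow L(c)$ are added to $\mathsf P$, for any choice of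 propositional symbols $q_{L,c}$ (in particular for pairwise different new ones). -/

import Mathlib

/-! Monodic first-order temporal problems in divided separated normal form, their semantics, and the
temporal resolution calculus.

A first-order temporal language is a first-order language `L` without function symbols of positive
arity: `L.Relations n` are the predicate symbols of arity `n` (propositions for `n = 0`) and
`L.Constants = L.Functions 0` are the individual constants.  `L.BoundedFormula Empty n` is the type
of first-order formulas whose free variables are among `&0, …, &(n-1)`.  Equality, which Mathlib's
formulas offer, is excluded by `EqFree`. -/

namespace MonodicFOTL

open FirstOrder FirstOrder.Language

/-! ### First-order formulas -/

section FirstOrderPart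

variable {L : FirstOrder.Language.{0, 0}}

/-- The formula does not contain the equality symbol. -/
def EqFree {α : Type} : ∀ {n : ℕ}, L.BoundedFormula α n → Prop
  | _, .falsum => True
  | _, .equal _ _ => False
  | _, .rel _ _ => True
  | _, .imp φ ψ => EqFree φ ∧ EqFree ψ
  | _, .all φ => EqFree φ

open Classical in
/-- The constants that occur in a term. -/
noncomputable def termConsts {α : Type} : L.Term α → Finset L.Constants
  | .var _ => ∅
  | .func (l := 0) c _ => {c}
  | .func (l := _ + 1) _ ts => Finset.univ.biUnion fun i => termConsts (ts i)

open Classical in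
/-- The constants that occur in a formula. -/
noncomputable def formulaConsts {α : Type} : ∀ {n : ℕ}, L.BoundedFormula α n → Finset L.Constants
  | _, .falsum => ∅
  | _, .equal t u => termConsts t ∪ termConsts u
  | _, .rel _ ts => Finset.univ.biUnion fun i => termConsts (ts i)
  | _, .imp φ ψ => formulaConsts φ ∪ formulaConsts ψ
  | _, .all φ => formulaConsts φ

/-- Finite conjunction; the empty one is true. -/
def conj {n : ℕ} (φs : List (L.BoundedFormula Empty n)) : L.BoundedFormula Empty n :=
  φs.foldr (· ⊓ ·) ⊤

/-- Finite disjunction; the empty one is false. -/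
def disj {n : ℕ} (φs : List (L.BoundedFormula Empty n)) : L.BoundedFormula Empty n :=
  φs.foldr (· ⊔ ·) ⊥

/-- `T ⊨ φ`: in all models of `T` (with nonempty domain) the formula `φ` is true under all values
of its free variables. -/
def Entails (T : L.Theory) {n : ℕ} (φ : L.BoundedFormula Empty n) : Prop :=
  Theory.ModelsBoundedFormula.{0, 0, 0} T φ

end FirstOrderPart

/-! ### Literals -/

/-- A literal over the symbols `A`: the atom itself (`sign = true`) or its negation. -/
structure Literal (A : Type) where
  sign : Bool
  atom : A

/-- Propositional literals `l`. -/
abbrev PropLit (L : FirstOrder.Language.{0, 0}) := Literal (L.Relations 0)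

/-- Unary literals `L(x)`. -/
abbrev UnaryLit (L : FirstOrder.Language.{0, 0}) := Literal (L.Relations 1)

/-- The formula `l`. -/
def PropLit.form {L : FirstOrder.Language.{0, 0}} {n : ℕ} (l : PropLit L) : L.BoundedFormula Empty n :=
  if l.sign then l.atom.boundedFormula ![] else (l.atom.boundedFormula ![]).not

/-- The formula `L(t)`. -/
def UnaryLit.at {L : FirstOrder.Language.{0, 0}} {n : ℕ} (l : UnaryLit L) (t : L.Term (Empty ⊕ Fin n)) :
    L.BoundedFormula Empty n :=
  if l.sign then l.atom.boundedFormula₁ t else (l.atom.boundedFormula₁ t).not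

/-- The formula `L(x)`, where `x` is the innermost (last) of the variables `&0, …, &n`. -/
def UnaryLit.atX {L : FirstOrder.Language.{0, 0}} {n : ℕ} (l : UnaryLit L) : L.BoundedFormula Empty (n + 1) :=
  UnaryLit.at l (Term.var (Sum.inr (Fin.last n)))

/-- Ground literals: propositional literals `l`, and literals `L(c)` with a constant `c`. -/
inductive GroundLit (L : FirstOrder.Language.{0, 0}) where
  | prop (l : PropLit L)
  | const (l : UnaryLit L) (c : L.Constants)

/-- The formula of a ground literal. -/
def GroundLit.form {L : FirstOrder.Language.{0, 0}} {n : ℕ} : GroundLit L → L.BoundedFormula Empty n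
  | .prop l => PropLit.form l
  | .const l c => UnaryLit.at l c.term

/-- The constants that occur in a ground literal. -/
def GroundLit.consts {L : FirstOrder.Language.{0, 0}} : GroundLit L → Finset L.Constants
  | .prop _ => ∅
  | .const _ c => {c}

/-! ### First-order temporal logic -/

/-- First-order temporal formulas with free variables among `&0, …, &(n-1)`, built from first-order
formulas.  The operators that are not listed are definable or do not occur in normal forms. -/
inductive TFormula (L : FirstOrder.Language.{0, 0}) : ℕ → Type
  | fo {n : ℕ} (φ : L.BoundedFormula Empty n) : TFormula L n
  | and {n : ℕ} (φ ψ : TFormula L n) : TFormula L n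
  | imp {n : ℕ} (φ ψ : TFormula L n) : TFormula L n
  | all {n : ℕ} (φ : TFormula L (n + 1)) : TFormula L n
  | next {n : ℕ} (φ : TFormula L n) : TFormula L n
  | sometime {n : ℕ} (φ : TFormula L n) : TFormula L n
  | always {n : ℕ} (φ : TFormula L n) : TFormula L n

/-- Finite conjunction of temporal formulas. -/
def TFormula.conj {L : FirstOrder.Language.{0, 0}} {n : ℕ} (φs : List (TFormula L n)) : TFormula L n :=
  φs.foldr TFormula.and (TFormula.fo ⊤)

/-- A first-order temporal structure: one nonempty domain, an interpretation of the symbols at every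
moment of time, constants being rigid. -/
structure TemporalStructure (L : FirstOrder.Language.{0, 0}) where
  D : Type
  nonempty : Nonempty D
  interp : ℕ → L.Structure D
  rigid : ∀ (c : L.Constants) (i j : ℕ),
    @constantMap L D (interp i) c = @constantMap L D (interp j) c

/-- Truth of a temporal formula at moment `t`, the variable `&i` having the value `xs i`. -/
def TemporalStructure.Holds {L : FirstOrder.Language.{0, 0}} (M : TemporalStructure L) :
    ∀ {n : ℕ}, ℕ → TFormula L n → (Fin n → M.D) → Prop
  | _, t, .fo φ, xs =>
      @BoundedFormula.Realize L M.D (M.interp t) Empty _ φ default xs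
  | _, t, .and φ ψ, xs => M.Holds t φ xs ∧ M.Holds t ψ xs
  | _, t, .imp φ ψ, xs => M.Holds t φ xs → M.Holds t ψ xs
  | _, t, .all φ, xs => ∀ d : M.D, M.Holds t φ (Fin.snoc xs d)
  | _, t, .next φ, xs => M.Holds (t + 1) φ xs
  | _, t, .sometime φ, xs => ∃ s, t ≤ s ∧ M.Holds s φ xs
  | _, t, .always φ, xs => ∀ s, t ≤ s → M.Holds s φ xs

/-- A closed temporal formula is satisfiable if it is true at moment `0` of some structure. -/
def TFormula.Satisfiable {L : FirstOrder.Language.{0, 0}} (φ : TFormula L 0) : Prop :=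
  ∃ M : TemporalStructure L, M.Holds 0 φ Fin.elim0

/-! ### Temporal problems -/

/-- The data of a temporal problem.  A pair `(l, m)` in a step part stands for `l ⇒ ○m`, a literal in
an eventuality part for the clause `◇l`. -/
structure TemporalProblem (L : FirstOrder.Language.{0, 0}) where
  /-- the universal part `U` -/
  univ : Finset L.Sentence
  /-- the initial part `I` -/
  init : Finset L.Sentence
  /-- the ground step clauses `l ⇒ ○m` -/
  stepGround : Finset (PropLit L × PropLit L)
  /-- the non-ground step clauses `L(x) ⇒ ○M(x)` -/
  stepUnary : Finset (UnaryLit L × UnaryLit L)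
  /-- the ground eventualities `◇l` -/
  evGround : Finset (GroundLit L)
  /-- the non-ground eventualities `◇L(x)` -/
  evUnary : Finset (UnaryLit L)

namespace TemporalProblem

variable {L : FirstOrder.Language.{0, 0}}

/-- `P` is a monodic temporal problem in divided separated normal form: the formulas of the universal
and the initial part are formulas of the logic (which has no equality), no two different step clauses
have the same left-hand side, and ground eventualities are propositional. -/
structure IsDSNF (P : TemporalProblem L) : Prop where
  eqFree_univ : ∀ φ ∈ P.univ, EqFree φ
  eqFree_init : ∀ φ ∈ P.init, EqFree φ
  stepGround_lhs : ∀ s ∈ P.stepGround, ∀ s' ∈ P.stepGround, s.1 = s'.1 → s = s'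
  stepUnary_lhs : ∀ s ∈ P.stepUnary, ∀ s' ∈ P.stepUnary, s.1 = s'.1 → s = s'
  evGround_prop : ∀ e ∈ P.evGround, ∃ l : PropLit L, e = GroundLit.prop l

/-- The step clauses, as temporal formulas in the variable `x = &0`. -/
noncomputable def stepFormulas (P : TemporalProblem L) : List (TFormula L 1) :=
  P.stepGround.toList.map (fun s =>
      TFormula.imp (.fo (PropLit.form s.1)) (.next (.fo (PropLit.form s.2)))) ++
    P.stepUnary.toList.map (fun s =>
      TFormula.imp (.fo (UnaryLit.atX s.1)) (.next (.fo (UnaryLit.atX s.2))))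

/-- The eventuality clauses, as temporal formulas in the variable `x = &0`. -/
noncomputable def evFormulas (P : TemporalProblem L) : List (TFormula L 1) :=
  P.evGround.toList.map (fun l => TFormula.sometime (.fo l.form)) ++
    P.evUnary.toList.map (fun l => TFormula.sometime (.fo (UnaryLit.atX l)))

/-- The formula `I ∧ □U ∧ □∀x S ∧ □∀x E` associated with a problem. -/
noncomputable def formula (P : TemporalProblem L) : TFormula L 0 :=
  .and (TFormula.conj (P.init.toList.map .fo)) <|
    .and (.always (TFormula.conj (P.univ.toList.map .fo))) <|
      .and (.always (.all (TFormula.conj P.stepFormulas)))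
        (.always (.all (TFormula.conj P.evFormulas)))

/-- A problem is satisfiable if its associated formula is. -/
def Satisfiable (P : TemporalProblem L) : Prop :=
  P.formula.Satisfiable

open Classical in
/-- `const(P)`: the constants that occur in the problem. -/
noncomputable def consts (P : TemporalProblem L) : Finset L.Constants :=
  P.univ.biUnion (fun φ => formulaConsts φ) ∪ P.init.biUnion (fun φ => formulaConsts φ) ∪
    P.evGround.biUnion GroundLit.consts

open Classical in
/-- The constant flooded form `P ∪ {◇L(c) | ◇L(x) ∈ E, c ∈ const(P)}`. -/
noncomputable def flooded (P : TemporalProblem L) : TemporalProblem L :=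
  { P with
    evGround := P.evGround ∪ (P.evUnary ×ˢ P.consts).image fun p => GroundLit.const p.1 p.2 }

open Classical in
/-- The constant flooded form in which the added eventualities `◇L(c)` are renamed by propositions:
`◇q` is added to the eventualities and `q → L(c)` to the universal part, where `q = name L c`. -/
noncomputable def floodedRenamed (P : TemporalProblem L)
    (name : UnaryLit L → L.Constants → L.Relations 0) : TemporalProblem L :=
  { P with
    univ := P.univ ∪ (P.evUnary ×ˢ P.consts).image fun p =>
      (PropLit.form ⟨true, name p.1 p.2⟩).imp (UnaryLit.at p.1 p.2.term)
    evGround := P.evGround ∪ (P.evUnary ×ˢ P.consts).image fun p =>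
      GroundLit.prop ⟨true, name p.1 p.2⟩ }

end TemporalProblem

/-! ### Merged step clauses -/

section Clauses

variable {L : FirstOrder.Language.{0, 0}}

/-- Derived step clauses and original ground step clauses.  For non-ground step clauses
`P₁(x) ⇒ ○M₁(x), …, Pₖ(x) ⇒ ○Mₖ(x)`:
* `univ`: `∀x (P₁(x) ∨ … ∨ Pₖ(x)) ⇒ ○∀x (M₁(x) ∨ … ∨ Mₖ(x))`;
* `exist`: `∃x (P₁(x) ∧ … ∧ Pₖ(x)) ⇒ ○∃x (M₁(x) ∧ … ∧ Mₖ(x))`;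
* `const`: `Pⱼ(c) ⇒ ○Mⱼ(c)`. -/
inductive DerivedClause (L : FirstOrder.Language.{0, 0}) where
  | univ (ss : List (UnaryLit L × UnaryLit L))
  | exist (ss : List (UnaryLit L × UnaryLit L))
  | const (s : UnaryLit L × UnaryLit L) (c : L.Constants)
  | ground (s : PropLit L × PropLit L)

namespace DerivedClause

/-- The clause is obtained from the step clauses and the constants of the problem `P`. -/
def Of (P : TemporalProblem L) : DerivedClause L → Prop
  | univ ss => ss ≠ [] ∧ ∀ s ∈ ss, s ∈ P.stepUnary
  | exist ss => ss ≠ [] ∧ ∀ s ∈ ss, s ∈ P.stepUnary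
  | const s c => s ∈ P.stepUnary ∧ c ∈ P.consts
  | ground s => s ∈ P.stepGround

/-- The left-hand side `Φ` of `Φ ⇒ ○Ψ`.  It is closed; the parameter `n` only says that it is
written down as a formula in `n` variables, none of which it contains. -/
def lhs {n : ℕ} : DerivedClause L → L.BoundedFormula Empty n
  | univ ss => (disj (ss.map fun s => UnaryLit.atX s.1)).all
  | exist ss => (conj (ss.map fun s => UnaryLit.atX s.1)).ex
  | const s c => UnaryLit.at s.1 c.term
  | ground s => PropLit.form s.1

/-- The formula `Ψ` of the right-hand side of `Φ ⇒ ○Ψ`. -/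
def rhs {n : ℕ} : DerivedClause L → L.BoundedFormula Empty n
  | univ ss => (disj (ss.map fun s => UnaryLit.atX s.2)).all
  | exist ss => (conj (ss.map fun s => UnaryLit.atX s.2)).ex
  | const s c => UnaryLit.at s.2 c.term
  | ground s => PropLit.form s.2

end DerivedClause

/-- A merged derived step clause `𝒜 ⇒ ○ℬ`, given by the clauses `Φᵢ ⇒ ○Ψᵢ` that are merged. -/
structure MergedClause (L : FirstOrder.Language.{0, 0}) where
  parts : List (DerivedClause L)

namespace MergedClause

/-- At least one clause is merged, and all come from the problem `P`. -/
def Of (P : TemporalProblem L) (m : MergedClause L) : Prop :=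
  m.parts ≠ [] ∧ ∀ d ∈ m.parts, d.Of P

/-- The closed formula `𝒜`, the conjunction of the `Φᵢ`. -/
def A {n : ℕ} (m : MergedClause L) : L.BoundedFormula Empty n :=
  conj (m.parts.map fun d => d.lhs)

/-- The closed formula `ℬ`, the conjunction of the `Ψᵢ`. -/
def B {n : ℕ} (m : MergedClause L) : L.BoundedFormula Empty n :=
  conj (m.parts.map fun d => d.rhs)

end MergedClause

/-- A full merged step clause `∀x (𝒜 ∧ A(x) ⇒ ○(ℬ ∧ B(x)))`, given by the merged derived step clause
`𝒜 ⇒ ○ℬ` and the non-ground step clauses (possibly none) that make up `A(x)` and `B(x)`. -/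
structure FullClause (L : FirstOrder.Language.{0, 0}) where
  merged : MergedClause L
  steps : List (UnaryLit L × UnaryLit L)

namespace FullClause

/-- The clause is obtained from the problem `P`. -/
def Of (P : TemporalProblem L) (f : FullClause L) : Prop :=
  f.merged.Of P ∧ ∀ s ∈ f.steps, s ∈ P.stepUnary

/-- The formula `A(x)`, where `x = &0`. -/
def Ax (f : FullClause L) : L.BoundedFormula Empty 1 :=
  conj (f.steps.map fun s => UnaryLit.atX s.1)

/-- The formula `B(x)`, where `x = &0`. -/
def Bx (f : FullClause L) : L.BoundedFormula Empty 1 :=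
  conj (f.steps.map fun s => UnaryLit.atX s.2)

end FullClause

/-! ### The calculus -/

/-- The side conditions of the eventuality resolution rule: the clauses `fs` are a loop in `◇L(x)`
with respect to the universal part `U`. -/
def IsLoop (U : L.Theory) (fs : List (FullClause L)) (l : UnaryLit L) : Prop :=
  ∀ f ∈ fs,
    Entails U ((f.merged.B ⊓ f.Bx).imp (UnaryLit.atX l).not).all ∧
    Entails U ((f.merged.B ⊓ f.Bx).imp (disj (fs.map fun g => g.merged.A ⊓ g.Ax))).all

/-- The side conditions of the ground eventuality resolution rule: the clauses `ms` are a ground loop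
in `◇l` with respect to the universal part `U`. -/
def IsGroundLoop (U : L.Theory) (ms : List (MergedClause L)) (l : GroundLit L) : Prop :=
  ∀ m ∈ ms,
    Entails (n := 0) U (m.B.imp l.form.not) ∧
    Entails (n := 0) U (m.B.imp (disj (ms.map fun m' => m'.A)))

/-- `Infers P U φ`: one of the rules, applied to the problem `P` with current universal part `U`, has
the conclusion `φ`. -/
inductive Infers (P : TemporalProblem L) (U : L.Theory) : L.Sentence → Prop
  /-- step resolution rule -/
  | stepResolution (m : MergedClause L) (hm : m.Of P)
      (h : Entails (n := 0) (U ∪ {m.B}) ⊥) :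
      Infers P U m.A.not
  /-- eventuality resolution rule -/
  | eventualityResolution (fs : List (FullClause L)) (hfs : ∀ f ∈ fs, f.Of P)
      (l : UnaryLit L) (hl : l ∈ P.evUnary) (h : IsLoop U fs l) :
      Infers P U (conj (fs.map fun f => f.merged.A.not ⊔ f.Ax.not)).all
  /-- ground eventuality resolution rule -/
  | groundEventualityResolution (ms : List (MergedClause L)) (hms : ∀ m ∈ ms, m.Of P)
      (l : GroundLit L) (hl : l ∈ P.evGround) (h : IsGroundLoop U ms l) :
      Infers P U (conj (ms.map fun m => m.A.not))

/-- One of the termination rules applies to the problem `P` with current universal part `U`. -/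
inductive Terminates (P : TemporalProblem L) (U : L.Theory) : Prop
  /-- initial termination rule -/
  | initial (h : Entails (n := 0) (U ∪ (P.init : Set L.Sentence)) ⊥)
  /-- eventuality termination rule -/
  | eventuality (l : UnaryLit L) (hl : l ∈ P.evUnary)
      (h : Entails (n := 0) U (UnaryLit.atX l).not.all)
  /-- ground eventuality termination rule -/
  | groundEventuality (l : GroundLit L) (hl : l ∈ P.evGround)
      (h : Entails (n := 0) U l.form.not)

/-- There is a successfully terminating derivation from `P`: a finite sequence of universal parts
`U₀ ⊆ U₁ ⊆ … ⊆ Uₖ`, the first being that of `P` and each further one extending its predecessor by the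
conclusion of a rule, such that a termination rule applies to `Uₖ`. -/
def HasSuccessfulDerivation (P : TemporalProblem L) : Prop :=
  ∃ (k : ℕ) (U : ℕ → L.Theory),
    U 0 = (P.univ : Set L.Sentence) ∧
    (∀ i < k, ∃ φ : L.Sentence, Infers P (U i) φ ∧ U (i + 1) = insert φ (U i)) ∧
    Terminates P (U k)

end Clauses

end MonodicFOTL

/-! The proof is by contraposition: if the flooded problem has no successful derivation, a temporal
model is built. Collect every formula derivable as part of some universal part into one theory, the
`saturation`. The rules are monotone, so derivations can be merged, and by compactness each premise
over the saturation already holds over one finite stage. Hence the saturation is closed under all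
rules (`mem_saturation_of_infers`), and no termination rule applies to it
(`hasSuccessfulDerivation_of_terminates`).

Take the models of the saturation as possible states, `B` following `A` when each derived or ground
step clause whose left side is true in `A` has its right side true in `B`. The conjunction of the
clauses firing in `A` is a merged clause, true on its left in `A`. If `A` had no successor, step
resolution would refute that left side in `A`; if a ground eventuality were unreachable from `A`,
the finitely many merged clauses firing in reachable models would form a loop, refuted in the same
way (`exists_modelSucc`, `exists_modelSucc_ground`). Pairs of a model and an element treat the other
eventualities (`exists_pointSucc_unary`).

The existential and universal derived clauses make elements of consecutive models match in both
directions. Since step clauses and eventualities only see the finitely many unary literals of the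
problem, elements can be replaced by finite types, so only countably many fairness demands arise and
are met by dovetailing (`TypedGraph.exists_fair_path`). The domain of the temporal model consists of
all fair runs along the resulting path, predicates at moment `n` being pulled back along evaluation
at `n`. Evaluation is onto, so formulas without equality keep their truth values. A constant is the
run of its own values; flooding is what makes this run fair. -/

namespace MonodicFOTL

open FirstOrder FirstOrder.Language

/-! ### Infinite paths -/

section Paths

/-- The sequence that follows `p` up to time `N` and `q` afterwards. -/
def splice {X : Type*} (N : ℕ) (p q : ℕ → X) (i : ℕ) : X :=
  if i ≤ N then p i else q i

theorem splice_of_le {X : Type*} {N : ℕ} {p q : ℕ → X} {i : ℕ} (h : i ≤ N) :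
    splice N p q i = p i := if_pos h

theorem splice_of_ge {X : Type*} {N : ℕ} {p q : ℕ → X} (h : p N = q N) {i : ℕ} (hi : N ≤ i) :
    splice N p q i = q i := by
  rcases hi.eq_or_lt with rfl | hi
  · rw [splice_of_le le_rfl, h]
  · exact if_neg (by omega)

theorem splice_step {X : Type*} {R : ℕ → X → X → Prop} {N : ℕ} {p q : ℕ → X} (h : p N = q N)
    (hp : ∀ i < N, R i (p i) (p (i + 1))) (hq : ∀ i, N ≤ i → R i (q i) (q (i + 1))) (i : ℕ) :
    R i (splice N p q i) (splice N p q (i + 1)) := by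
  rcases lt_or_ge i N with hi | hi
  · rw [splice_of_le hi.le, splice_of_le hi]; exact hp i hi
  · rw [splice_of_ge h hi, splice_of_ge h (by omega)]; exact hq i hi

/-- Countably many requirements, each of which can be met by changing the future of a path and is
then settled by a finite part of the path, can be met simultaneously. -/
theorem exists_path_forall_of_extendable {X ι : Type*} [Countable ι] (R : ℕ → X → X → Prop)
    (Req : ι → (ℕ → X) → Prop)
    (h : ∀ j (p : ℕ → X), (∀ i, R i (p i) (p (i + 1))) → ∀ N : ℕ, ∃ p' : ℕ → X,
      (∀ i, R i (p' i) (p' (i + 1))) ∧ (∀ i ≤ N, p' i = p i) ∧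
      ∃ N', ∀ q : ℕ → X, (∀ i ≤ N', q i = p' i) → Req j q)
    (p : ℕ → X) (hp : ∀ i, R i (p i) (p (i + 1))) (N : ℕ) :
    ∃ q : ℕ → X, (∀ i, R i (q i) (q (i + 1))) ∧ (∀ i ≤ N, q i = p i) ∧ ∀ j, Req j q := by
  rcases isEmpty_or_nonempty ι with _ | _
  · exact ⟨p, hp, fun _ _ => rfl, isEmptyElim⟩
  obtain ⟨e, he⟩ := exists_surjective_nat ι
  -- A stage is a path together with a bound up to which it is frozen; stage `k` settles the
  -- requirement `e k` without touching the frozen prefix.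
  let S := {x : (ℕ → X) × ℕ // ∀ i, R i (x.1 i) (x.1 (i + 1))}
  have step : ∀ (k : ℕ) (x : S), ∃ y : S, (∀ i ≤ x.1.2, y.1.1 i = x.1.1 i) ∧ x.1.2 < y.1.2 ∧
      ∀ q : ℕ → X, (∀ i ≤ y.1.2, q i = y.1.1 i) → Req (e k) q := by
    rintro k ⟨⟨r, M⟩, hr⟩
    obtain ⟨p', h1, h2, N', h3⟩ := h (e k) r hr M
    -- Taking at least `M + 1` lets the frozen prefix grow at each stage, so the limit is defined
    -- everywhere.
    exact ⟨⟨⟨p', max (M + 1) N'⟩, h1⟩, h2, lt_of_lt_of_le (Nat.lt_succ_self M) (le_max_left _ _),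
      fun q hq => h3 q fun i hi => hq i (hi.trans (le_max_right _ _))⟩
  choose f hf1 hf2 hf3 using step
  let s : ℕ → S := fun n => Nat.rec ⟨⟨p, N⟩, hp⟩ (fun k x => f k x) n
  have hs : ∀ n, s (n + 1) = f n (s n) := fun _ => rfl
  have hlt : ∀ n, (s n).1.2 < (s (n + 1)).1.2 := fun n => hf2 n (s n)
  have hmono : StrictMono fun n => (s n).1.2 := strictMono_nat_of_lt_succ hlt
  have hle : ∀ n, n ≤ (s n).1.2 := fun n => hmono.le_apply
  have hagree : ∀ n k, ∀ i ≤ (s n).1.2, (s (n + k)).1.1 i = (s n).1.1 i := by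
    intro n k
    induction k with
    | zero => intro i _; rfl
    | succ k ih =>
      intro i hi
      rw [← ih i hi]
      exact hf1 (n + k) (s (n + k)) i (hi.trans (hmono.monotone (Nat.le_add_right n k)))
  -- The limit is the diagonal: by stage `i` the entry at `i` is frozen, and it agrees with all
  -- other stages that freeze it.
  have hlim : ∀ n, ∀ i ≤ (s n).1.2, (s i).1.1 i = (s n).1.1 i := by
    intro n i hi
    rcases le_total n i with h' | h'
    · obtain ⟨k, rfl⟩ := Nat.exists_eq_add_of_le h'
      exact hagree n k _ hi
    · obtain ⟨k, rfl⟩ := Nat.exists_eq_add_of_le h'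
      exact (hagree i k _ (hle i)).symm
  refine ⟨fun i => (s i).1.1 i, fun i => ?_, fun i hi => hlim 0 i hi, fun j => ?_⟩
  · change R i ((s i).1.1 i) ((s (i + 1)).1.1 (i + 1))
    rw [hlim (i + 1) i (by have := hle (i + 1); omega)]
    exact (s (i + 1)).2 i
  · obtain ⟨k, rfl⟩ := he j
    exact hf3 k (s k) _ fun i hi => hlim (k + 1) i hi

theorem exists_path_of_serial {X : Type*} {E : X → X → Prop} (hE : ∀ x, ∃ y, E x y) (x : X) :
    ∃ q : ℕ → X, q 0 = x ∧ ∀ i, E (q i) (q (i + 1)) := by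
  choose f hf using hE
  exact ⟨fun n => Nat.rec x (fun _ y => f y) n, rfl, fun i => hf _⟩

theorem exists_path_of_reflTransGen {X : Type*} {E : X → X → Prop} (hE : ∀ x, ∃ y, E x y) {x y : X}
    (h : Relation.ReflTransGen E x y) :
    ∃ q : ℕ → X, q 0 = x ∧ (∀ i, E (q i) (q (i + 1))) ∧ ∃ k, q k = y := by
  induction h using Relation.ReflTransGen.head_induction_on with
  | refl =>
    obtain ⟨q, h0, hq⟩ := exists_path_of_serial hE y
    exact ⟨q, h0, hq, 0, h0⟩
  | head h _ ih =>
    obtain ⟨q, h0, hq, k, hk⟩ := ih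
    refine ⟨fun i => Nat.casesOn i _ q, by rfl, fun i => ?_, k + 1, hk⟩
    cases i with
    | zero => subst h0; exact h
    | succ i => exact hq i

/-- The strict inequality `0 < k` is what later lets a goal be reached again after any given moment.
-/
theorem exists_path_of_transGen {X : Type*} {E : X → X → Prop} (hE : ∀ x, ∃ y, E x y) {x y : X}
    (h : Relation.TransGen E x y) :
    ∃ q : ℕ → X, q 0 = x ∧ (∀ i, E (q i) (q (i + 1))) ∧ ∃ k, 0 < k ∧ q k = y := by
  obtain ⟨z, hxz, hzy⟩ := Relation.TransGen.head'_iff.1 h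
  obtain ⟨q, h0, hq, k, hk⟩ := exists_path_of_reflTransGen hE hzy
  refine ⟨fun i => Nat.casesOn i x q, rfl, fun i => ?_, k + 1, k.succ_pos, hk⟩
  cases i with
  | zero => subst h0; exact hxz
  | succ i => exact hq i

/-! ### Runs and fair paths in typed graphs. -/

/-- Nodes `N` with sets `T A` of element types that are realized in the node `A`; `E` is the
successor relation of nodes and `C` that of element types. -/
structure TypedGraph (N 𝕋 : Type*) where
  E : N → N → Prop
  T : N → Set 𝕋
  C : 𝕋 → 𝕋 → Prop
  serial : ∀ A, ∃ B, E A B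
  forth : ∀ {A B}, E A B → ∀ τ ∈ T A, ∃ σ ∈ T B, C τ σ
  back : ∀ {A B}, E A B → ∀ σ ∈ T B, ∃ τ ∈ T A, C τ σ

namespace TypedGraph

variable {N 𝕋 : Type*} (G : TypedGraph N 𝕋)

/-- The successor relation of nodes with a distinguished element type. -/
def Pair (x y : N × 𝕋) : Prop :=
  G.E x.1 y.1 ∧ x.2 ∈ G.T x.1 ∧ y.2 ∈ G.T y.1 ∧ G.C x.2 y.2

/-- A run: a sequence of element types along a path. -/
def Run (p : ℕ → N) (i : ℕ) (τ σ : 𝕋) : Prop :=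
  τ ∈ G.T (p i) ∧ σ ∈ G.T (p (i + 1)) ∧ G.C τ σ

variable {G}

/-- `forth` makes the relation on pairs of a moment and a type realized there serial; a path of it
is a run. -/
theorem exists_run_from {p : ℕ → N} (hp : ∀ i, G.E (p i) (p (i + 1))) (n : ℕ) {τ : 𝕋}
    (hτ : τ ∈ G.T (p n)) : ∃ r : ℕ → 𝕋, r n = τ ∧ ∀ i, n ≤ i → G.Run p i (r i) (r (i + 1)) := by
  obtain ⟨q, h0, hq⟩ := exists_path_of_serial
    (E := fun x y : {x : ℕ × 𝕋 // x.2 ∈ G.T (p x.1)} => y.1.1 = x.1.1 + 1 ∧ G.C x.1.2 y.1.2)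
    (fun x => by
      obtain ⟨σ, hσ, hC⟩ := G.forth (hp x.1.1) x.1.2 x.2
      exact ⟨⟨(x.1.1 + 1, σ), hσ⟩, rfl, hC⟩) ⟨(n, τ), hτ⟩
  have hidx : ∀ i, (q i).1.1 = n + i := by
    intro i
    induction i with
    | zero => rw [h0]; rfl
    | succ i ih => rw [(hq i).1, ih, Nat.add_assoc]
  have hT : ∀ i, (q i).1.2 ∈ G.T (p (n + i)) := fun i => hidx i ▸ (q i).2
  -- Truncated subtraction keeps the value `τ` before `n`, where nothing is claimed.
  refine ⟨fun i => (q (i - n)).1.2, by simp [h0], fun i hi => ?_⟩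
  obtain ⟨k, rfl⟩ := Nat.exists_eq_add_of_le hi
  simp only [Run, Nat.add_assoc, Nat.add_sub_cancel_left]
  exact ⟨hT k, hT (k + 1), (hq k).2⟩

/-- Induction on `n`: `back` supplies a predecessor type at each earlier moment, `exists_run_from`
the future. -/
theorem exists_run_through {p : ℕ → N} (hp : ∀ i, G.E (p i) (p (i + 1))) (n : ℕ) {τ : 𝕋}
    (hτ : τ ∈ G.T (p n)) : ∃ r : ℕ → 𝕋, r n = τ ∧ ∀ i, G.Run p i (r i) (r (i + 1)) := by
  induction n generalizing τ with
  | zero =>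
    obtain ⟨r, h0, hr⟩ := exists_run_from hp 0 hτ
    exact ⟨r, h0, fun i => hr i i.zero_le⟩
  | succ n ih =>
    obtain ⟨σ, hσ, hC⟩ := G.back (hp n) τ hτ
    obtain ⟨r, h0, hr⟩ := ih hσ
    obtain ⟨t, t0, ht⟩ := exists_run_from hp (n + 1) hτ
    refine ⟨fun i => if i ≤ n then r i else t i, by simp [t0], fun i => ?_⟩
    rcases lt_trichotomy i n with hi | rfl | hi
    · simpa [hi.le, Nat.succ_le_of_lt hi] using hr i
    · simpa [h0, t0, Run] using ⟨hσ, hτ, hC⟩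
    · simpa [hi.not_ge, (hi.trans (Nat.lt_succ_self i)).not_ge] using ht i hi

/-- If goals for nodes and for element types can be reached from everywhere, then some path reaches
all goals for nodes infinitely often, and all its element types lie on runs that reach all goals for
element types infinitely often. -/
theorem exists_fair_path {ι κ : Type*} [Countable ι] [Countable κ] [Countable 𝕋]
    (g : ι → Set N) (h : κ → Set 𝕋)
    (hg : ∀ j A, ∃ B ∈ g j, Relation.TransGen G.E A B)
    (hh : ∀ j A, ∀ τ ∈ G.T A, ∃ B, ∃ σ ∈ h j, Relation.TransGen G.Pair (A, τ) (B, σ)) (A : N) :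
    ∃ p : ℕ → N, p 0 = A ∧ (∀ i, G.E (p i) (p (i + 1))) ∧ (∀ j n, ∃ m, n < m ∧ p m ∈ g j) ∧
      ∀ n, ∀ τ ∈ G.T (p n), ∃ r : ℕ → 𝕋, r n = τ ∧ (∀ i, G.Run p i (r i) (r (i + 1))) ∧
        ∀ j n, ∃ m, n < m ∧ r m ∈ h j := by
  -- A type demands only a finite run segment reaching its goal, so that a finite part of the path
  -- settles the demand. Countability of `𝕋` makes the demands countable.
  let Req : (ι × ℕ) ⊕ (κ × ℕ × 𝕋) → (ℕ → N) → Prop := fun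
    | .inl (j, n), p => ∃ m, n < m ∧ p m ∈ g j
    | .inr (j, n, τ), p => τ ∈ G.T (p n) → ∃ m, n < m ∧ ∃ r : ℕ → 𝕋, r n = τ ∧
        (∀ i < m, G.Run p i (r i) (r (i + 1))) ∧ r m ∈ h j
  have hReq : ∀ j (p : ℕ → N), (∀ i, G.E (p i) (p (i + 1))) → ∀ N' : ℕ, ∃ p' : ℕ → N,
      (∀ i, G.E (p' i) (p' (i + 1))) ∧ (∀ i ≤ N', p' i = p i) ∧
      ∃ K, ∀ q : ℕ → N, (∀ i ≤ K, q i = p' i) → Req j q := by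
    rintro (⟨j, n⟩ | ⟨j, n, τ⟩) p hp N'
    · set M := max N' n
      obtain ⟨B, hB, hAB⟩ := hg j (p M)
      obtain ⟨q, q0, hq, k, hk, rfl⟩ := exists_path_of_transGen G.serial hAB
      have heq : p M = (fun i => q (i - M)) M := by simp [q0]
      refine ⟨splice M p fun i => q (i - M), fun i => ?_, fun i hi =>
        splice_of_le (hi.trans (le_max_left _ _)), M + k, fun s hs => ⟨M + k, ?_, ?_⟩⟩
      · refine splice_step (R := fun _ => G.E) heq (fun i _ => hp i) (fun i hi => ?_) i
        rw [Nat.sub_add_comm hi]; exact hq _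
      · have := le_max_right N' n; omega
      · rw [hs _ le_rfl, splice_of_ge heq (by omega)]; simpa using hB
    · by_cases hτ : τ ∈ G.T (p n)
      swap
      · exact ⟨p, hp, fun _ _ => rfl, n, fun q hq h' => absurd (hq n le_rfl ▸ h') hτ⟩
      obtain ⟨r, r0, hr⟩ := exists_run_through hp n hτ
      set M := max N' n with hM
      obtain ⟨B, σ, hσ, hAB⟩ := hh j (p M) (r M) (hr M).1
      -- `Pair` is serial only on pairs whose type is realized in the node, so paths are taken in
      -- that subtype.
      have hser : ∀ x : {x : N × 𝕋 // x.2 ∈ G.T x.1}, ∃ y : {x : N × 𝕋 // x.2 ∈ G.T x.1},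
          G.Pair x.1 y.1 := fun x => by
        obtain ⟨B, hB⟩ := G.serial x.1.1
        obtain ⟨σ, hσ, hC⟩ := G.forth hB _ x.2
        exact ⟨⟨(B, σ), hσ⟩, hB, x.2, hσ, hC⟩
      have hlift : ∀ {x y : N × 𝕋}, Relation.TransGen G.Pair x y → ∀ hx : x.2 ∈ G.T x.1,
          ∃ hy : y.2 ∈ G.T y.1, Relation.TransGen
            (fun a b : {x : N × 𝕋 // x.2 ∈ G.T x.1} => G.Pair a.1 b.1) ⟨x, hx⟩ ⟨y, hy⟩ := by
        intro x y hxy hx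
        induction hxy with
        | single h => exact ⟨h.2.2.1, .single h⟩
        | tail _ h ih => exact ⟨h.2.2.1, ih.2.tail h⟩
      obtain ⟨hy, hAB⟩ := hlift hAB (hr M).1
      obtain ⟨q, q0, hq, k, hk, hqk⟩ := exists_path_of_transGen hser hAB
      let s := splice M (fun i => (p i, r i)) fun i => (q (i - M)).1
      have heq : (fun i => (p i, r i)) M = (fun i => (q (i - M)).1) M := by simp [q0]
      have hs : ∀ i, G.Pair (s i) (s (i + 1)) := by
        refine splice_step (R := fun _ => G.Pair) heq
          (fun i _ => ⟨hp i, (hr i).1, (hr i).2.1, (hr i).2.2⟩) (fun i hi => ?_)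
        rw [Nat.sub_add_comm hi]; exact hq _
      have hsle : ∀ i ≤ M, s i = (p i, r i) := fun i hi => splice_of_le hi
      refine ⟨fun i => (s i).1, fun i => (hs i).1, fun i hi => ?_, M + k, fun t ht _ =>
        ⟨M + k, ?_, fun i => (s i).2, ?_, fun i hi => ?_, ?_⟩⟩
      · change (s i).1 = _
        rw [hsle i (hi.trans (le_max_left _ _))]
      · have := le_max_right N' n; omega
      · change (s n).2 = _
        rw [hsle n (le_max_right _ _)]; exact r0
      · unfold Run
        rw [ht i hi.le, ht (i + 1) hi]
        exact (hs i).2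
      · have : s (M + k) = (q (M + k - M)).1 := splice_of_ge heq (by omega)
        change (s (M + k)).2 ∈ _
        rw [this, Nat.add_sub_cancel_left, hqk]; exact hσ
  obtain ⟨q₀, q0, hq₀⟩ := exists_path_of_serial G.serial A
  obtain ⟨p, hp, hp0, hpR⟩ :=
    exists_path_forall_of_extendable (fun _ => G.E) Req hReq q₀ hq₀ 0
  refine ⟨p, by rw [hp0 0 le_rfl, q0], hp, fun j n => hpR (.inl (j, n)), fun n τ hτ => ?_⟩
  obtain ⟨r, rn, hr⟩ := exists_run_through hp n hτ
  -- A second dovetailing, now of runs along the fixed path `p`: the segment promised at `(j, M, r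
  -- M)` is spliced onto `r` at `M` and then continued arbitrarily.
  have hruns : ∀ (x : κ × ℕ) (r : ℕ → 𝕋), (∀ i, G.Run p i (r i) (r (i + 1))) → ∀ N' : ℕ,
      ∃ r' : ℕ → 𝕋, (∀ i, G.Run p i (r' i) (r' (i + 1))) ∧ (∀ i ≤ N', r' i = r i) ∧
        ∃ K, ∀ q : ℕ → 𝕋, (∀ i ≤ K, q i = r' i) → ∃ m, x.2 < m ∧ q m ∈ h x.1 := by
    rintro ⟨j, k⟩ r hr N'
    set M := max N' k
    obtain ⟨m, hMm, r₁, h₁, hr₁, hm⟩ := hpR (.inr (j, M, r M)) (hr M).1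
    have hmT : r₁ m ∈ G.T (p m) := by
      obtain ⟨m, rfl⟩ : ∃ m', m = m' + 1 := ⟨m - 1, by omega⟩
      exact (hr₁ m (Nat.lt_succ_self m)).2.1
    obtain ⟨r₂, h₂, hr₂⟩ := exists_run_through hp m hmT
    have e₂ : r₁ m = r₂ m := h₂.symm
    have e₁ : r M = splice m r₁ r₂ M := by rw [splice_of_le hMm.le, h₁]
    refine ⟨splice M r (splice m r₁ r₂), splice_step e₁ (fun i _ => hr i)
      (fun i _ => splice_step e₂ hr₁ (fun i _ => hr₂ i) i),
      fun i hi => splice_of_le (hi.trans (le_max_left _ _)), m, fun q hq => ⟨m, ?_, ?_⟩⟩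
    · exact lt_of_le_of_lt (le_max_right N' k) hMm
    · rw [hq m le_rfl, splice_of_ge e₁ hMm.le, splice_of_le le_rfl]; exact hm
  obtain ⟨r', hr', hr'n, hall⟩ := exists_path_forall_of_extendable (G.Run p)
    (fun (x : κ × ℕ) q => ∃ m, x.2 < m ∧ q m ∈ h x.1) hruns r hr n
  exact ⟨r', by rw [hr'n n le_rfl, rn], hr', fun j n => hall (j, n)⟩

end TypedGraph

end Paths

/-! ### Semantics of literals and clauses -/

section Semantics

variable {L : FirstOrder.Language.{0, 0}}

theorem realize_conj_map {A ι : Type} [L.Structure A] {n : ℕ} (is : List ι)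
    (φ : ι → L.BoundedFormula Empty n) (v : Empty → A) (xs : Fin n → A) :
    (conj (is.map φ)).Realize v xs ↔ ∀ i ∈ is, (φ i).Realize v xs := by
  rw [conj, BoundedFormula.realize_foldr_inf, List.forall_mem_map]

theorem realize_disj_map {A ι : Type} [L.Structure A] {n : ℕ} (is : List ι)
    (φ : ι → L.BoundedFormula Empty n) (v : Empty → A) (xs : Fin n → A) :
    (disj (is.map φ)).Realize v xs ↔ ∃ i ∈ is, (φ i).Realize v xs := by
  rw [disj, BoundedFormula.realize_foldr_sup]
  simp only [List.mem_map, exists_exists_and_eq_and]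

/-- The element `a` satisfies the literal `l(x)`. -/
def UnaryLit.TrueAt {A : Type} [L.Structure A] (l : UnaryLit L) (a : A) : Prop :=
  l.sign = true ↔ Structure.RelMap l.atom ![a]

/-- The propositional literal `l` is true in `A`. -/
def PropLit.TrueIn (A : Type) [L.Structure A] (l : PropLit L) : Prop :=
  l.sign = true ↔ Structure.RelMap l.atom (![] : Fin 0 → A)

/-- The ground literal `l` is true in `A`. -/
def GroundLit.TrueIn (A : Type) [L.Structure A] : GroundLit L → Prop
  | .prop l => PropLit.TrueIn A l
  | .const l c => UnaryLit.TrueAt l (c : A)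

theorem UnaryLit.realize_at {A : Type} [L.Structure A] {n : ℕ} (l : UnaryLit L)
    (t : L.Term (Empty ⊕ Fin n)) (v : Empty → A) (xs : Fin n → A) :
    (UnaryLit.at l t).Realize v xs ↔ UnaryLit.TrueAt l (t.realize (Sum.elim v xs)) := by
  unfold UnaryLit.at UnaryLit.TrueAt
  cases l.sign <;> simp [BoundedFormula.realize_rel₁]

theorem UnaryLit.realize_at_const {A : Type} [L.Structure A] {n : ℕ} (l : UnaryLit L)
    (c : L.Constants) (v : Empty → A) (xs : Fin n → A) :
    (UnaryLit.at l c.term).Realize v xs ↔ UnaryLit.TrueAt l (c : A) := by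
  rw [UnaryLit.realize_at, Term.realize_constants]

theorem UnaryLit.realize_atX {A : Type} [L.Structure A] {n : ℕ} (l : UnaryLit L)
    (v : Empty → A) (xs : Fin n → A) (a : A) :
    (UnaryLit.atX l).Realize v (Fin.snoc xs a : Fin (n + 1) → A) ↔ UnaryLit.TrueAt l a := by
  rw [UnaryLit.atX, UnaryLit.realize_at]
  simp

theorem PropLit.realize_form {A : Type} [L.Structure A] {n : ℕ} (l : PropLit L)
    (v : Empty → A) (xs : Fin n → A) : (PropLit.form l).Realize v xs ↔ PropLit.TrueIn A l := by
  unfold PropLit.form PropLit.TrueIn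
  have : (fun i => Term.realize (Sum.elim v xs) ((![] : Fin 0 → L.Term (Empty ⊕ Fin n)) i)) = ![] :=
    Subsingleton.elim _ _
  cases l.sign <;> simp [BoundedFormula.realize_rel, this]

theorem GroundLit.realize_form {A : Type} [L.Structure A] {n : ℕ} (l : GroundLit L)
    (v : Empty → A) (xs : Fin n → A) : l.form.Realize v xs ↔ l.TrueIn A := by
  cases l with
  | prop l => exact PropLit.realize_form l v xs
  | const l c => exact UnaryLit.realize_at_const l c v xs

namespace DerivedClause

/-- The left-hand side of the clause is true in `A`. -/
def LhsTrue (A : Type) [L.Structure A] : DerivedClause L → Prop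
  | univ ss => ∀ a : A, ∃ s ∈ ss, UnaryLit.TrueAt s.1 a
  | exist ss => ∃ a : A, ∀ s ∈ ss, UnaryLit.TrueAt s.1 a
  | const s c => UnaryLit.TrueAt s.1 (c : A)
  | ground s => PropLit.TrueIn A s.1

/-- The formula of the right-hand side of the clause is true in `A`. -/
def RhsTrue (A : Type) [L.Structure A] : DerivedClause L → Prop
  | univ ss => ∀ a : A, ∃ s ∈ ss, UnaryLit.TrueAt s.2 a
  | exist ss => ∃ a : A, ∀ s ∈ ss, UnaryLit.TrueAt s.2 a
  | const s c => UnaryLit.TrueAt s.2 (c : A)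
  | ground s => PropLit.TrueIn A s.2

theorem realize_lhs {A : Type} [L.Structure A] {n : ℕ} (d : DerivedClause L) (v : Empty → A)
    (xs : Fin n → A) : d.lhs.Realize v xs ↔ d.LhsTrue A := by
  cases d with
  | univ ss => simp [lhs, LhsTrue, realize_disj_map, UnaryLit.realize_atX]
  | exist ss => simp [lhs, LhsTrue, realize_conj_map, UnaryLit.realize_atX]
  | const s c => exact UnaryLit.realize_at_const _ _ _ _
  | ground s => exact PropLit.realize_form _ _ _

theorem realize_rhs {A : Type} [L.Structure A] {n : ℕ} (d : DerivedClause L) (v : Empty → A)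
    (xs : Fin n → A) : d.rhs.Realize v xs ↔ d.RhsTrue A := by
  cases d with
  | univ ss => simp [rhs, RhsTrue, realize_disj_map, UnaryLit.realize_atX]
  | exist ss => simp [rhs, RhsTrue, realize_conj_map, UnaryLit.realize_atX]
  | const s c => exact UnaryLit.realize_at_const _ _ _ _
  | ground s => exact PropLit.realize_form _ _ _

end DerivedClause

theorem MergedClause.realize_A {A : Type} [L.Structure A] {n : ℕ} (m : MergedClause L)
    (v : Empty → A) (xs : Fin n → A) : m.A.Realize v xs ↔ ∀ d ∈ m.parts, d.LhsTrue A := by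
  simp [MergedClause.A, realize_conj_map, DerivedClause.realize_lhs]

theorem MergedClause.realize_B {A : Type} [L.Structure A] {n : ℕ} (m : MergedClause L)
    (v : Empty → A) (xs : Fin n → A) : m.B.Realize v xs ↔ ∀ d ∈ m.parts, d.RhsTrue A := by
  simp [MergedClause.B, realize_conj_map, DerivedClause.realize_rhs]

theorem FullClause.realize_Ax {A : Type} [L.Structure A] (f : FullClause L)
    (v : Empty → A) (xs : Fin 0 → A) (a : A) :
    f.Ax.Realize v (Fin.snoc xs a : Fin 1 → A) ↔ ∀ s ∈ f.steps, UnaryLit.TrueAt s.1 a := by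
  simp [FullClause.Ax, realize_conj_map, UnaryLit.realize_atX]

theorem FullClause.realize_Bx {A : Type} [L.Structure A] (f : FullClause L)
    (v : Empty → A) (xs : Fin 0 → A) (a : A) :
    f.Bx.Realize v (Fin.snoc xs a : Fin 1 → A) ↔ ∀ s ∈ f.steps, UnaryLit.TrueAt s.2 a := by
  simp [FullClause.Bx, realize_conj_map, UnaryLit.realize_atX]

/-! ### Formulas without equality and surjective homomorphisms -/

/-- Without function symbols of positive arity a term is a variable or a constant. -/
theorem realize_term_comp (hL : ∀ n : ℕ, IsEmpty (L.Functions (n + 1))) {A B : Type}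
    [L.Structure A] [L.Structure B] (f : A → B) {α : Type} (t : L.Term α)
    (hc : ∀ c ∈ termConsts t, f (c : A) = (c : B)) (v : α → A) :
    t.realize (f ∘ v) = f (t.realize v) := by
  cases t with
  | var i => rfl
  | @func l c ts =>
    cases l with
    | zero =>
      have h := hc c (by simp [termConsts])
      have hA : (Term.func c ts).realize v = ((c : L.Constants) : A) :=
        congrArg (Structure.funMap c) (Subsingleton.elim _ _)
      have hB : (Term.func c ts).realize (f ∘ v) = ((c : L.Constants) : B) :=
        congrArg (Structure.funMap c) (Subsingleton.elim _ _)
      rw [hA, hB, h]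
    | succ l => exact ((hL l).false c).elim

/-- A surjection that reflects and preserves the predicates and preserves the constants of a formula
without equality preserves the truth of the formula. -/
theorem realize_comp_of_surjective (hL : ∀ n : ℕ, IsEmpty (L.Functions (n + 1))) {A B : Type}
    [L.Structure A] [L.Structure B] (f : A → B) (hf : Function.Surjective f)
    (hrel : ∀ {k : ℕ} (R : L.Relations k) (xs : Fin k → A),
      Structure.RelMap R (f ∘ xs) ↔ Structure.RelMap R xs) {α : Type} {n : ℕ}
    (φ : L.BoundedFormula α n) (hφ : EqFree φ)
    (hc : ∀ c ∈ formulaConsts φ, f (c : A) = (c : B)) (v : α → A) (xs : Fin n → A) :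
    φ.Realize (f ∘ v) (f ∘ xs) ↔ φ.Realize v xs := by
  induction φ with
  | falsum => rfl
  | equal => exact hφ.elim
  | rel R ts =>
    have : (fun i => (ts i).realize (Sum.elim (f ∘ v) (f ∘ xs))) =
        f ∘ fun i => (ts i).realize (Sum.elim v xs) := by
      funext i
      rw [← Sum.comp_elim]
      exact realize_term_comp hL f (ts i)
        (fun c h => hc c (by
          classical exact Finset.mem_biUnion.2 ⟨i, Finset.mem_univ _, h⟩)) _
    change Structure.RelMap R _ ↔ Structure.RelMap R _
    rw [this, hrel]
  | imp φ ψ ih₁ ih₂ =>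
    have h₁ := ih₁ hφ.1 (fun c h => hc c (by classical exact Finset.mem_union_left _ h)) xs
    have h₂ := ih₂ hφ.2 (fun c h => hc c (by classical exact Finset.mem_union_right _ h)) xs
    rw [BoundedFormula.realize_imp, BoundedFormula.realize_imp, h₁, h₂]
  | all φ ih =>
    rw [BoundedFormula.realize_all, BoundedFormula.realize_all, hf.forall]
    refine forall_congr' fun a => ?_
    rw [← ih hφ hc (Fin.snoc xs a), Fin.comp_snoc]

end Semantics

/-! ### Saturation -/

section Saturation

variable {L : FirstOrder.Language.{0, 0}}

theorem Entails.mono {T T' : L.Theory} (h : T ⊆ T') {n : ℕ} {φ : L.BoundedFormula Empty n}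
    (hφ : Entails T φ) : Entails T' φ :=
  fun M v xs => hφ (M.subtheoryModel h) v xs

theorem Infers.mono {P : TemporalProblem L} {U U' : L.Theory} (h : U ⊆ U') {φ : L.Sentence}
    (hφ : Infers P U φ) : Infers P U' φ := by
  cases hφ with
  | stepResolution m hm h' =>
    exact .stepResolution m hm (h'.mono (Set.union_subset_union_left _ h))
  | eventualityResolution fs hfs l hl h' =>
    exact .eventualityResolution fs hfs l hl fun f hf => ⟨(h' f hf).1.mono h, (h' f hf).2.mono h⟩
  | groundEventualityResolution ms hms l hl h' =>
    exact .groundEventualityResolution ms hms l hl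
      fun m hm => ⟨(h' m hm).1.mono h, (h' m hm).2.mono h⟩

/-- The universal parts that occur in derivations from `P`. -/
inductive Derivable (P : TemporalProblem L) : L.Theory → Prop
  | base : Derivable P (P.univ : Set L.Sentence)
  | step {U : L.Theory} {φ : L.Sentence} (hU : Derivable P U) (h : Infers P U φ) :
      Derivable P (insert φ U)

theorem Derivable.univ_subset {P : TemporalProblem L} {U : L.Theory} (h : Derivable P U) :
    (P.univ : Set L.Sentence) ⊆ U := by
  induction h with
  | base => exact le_rfl
  | step _ _ ih => exact ih.trans (Set.subset_insert _ _)

/-- The second derivation can be replayed on top of the first, because the rules are monotone in the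
universal part. -/
theorem Derivable.union {P : TemporalProblem L} {U U' : L.Theory} (h : Derivable P U)
    (h' : Derivable P U') : Derivable P (U ∪ U') := by
  induction h' with
  | base => rwa [Set.union_eq_self_of_subset_right h.univ_subset]
  | step _ hφ ih =>
    rw [Set.union_insert]
    exact ih.step (hφ.mono Set.subset_union_right)

theorem Derivable.exists_sequence {P : TemporalProblem L} {U : L.Theory} (h : Derivable P U) :
    ∃ (k : ℕ) (V : ℕ → L.Theory), V 0 = (P.univ : Set L.Sentence) ∧
      (∀ i < k, ∃ φ : L.Sentence, Infers P (V i) φ ∧ V (i + 1) = insert φ (V i)) ∧ V k = U := by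
  induction h with
  | base => exact ⟨0, fun _ => _, rfl, fun _ h => absurd h (Nat.not_lt_zero _), rfl⟩
  | @step U φ _ hφ ih =>
    obtain ⟨k, V, h0, hV, rfl⟩ := ih
    refine ⟨k + 1, fun i => if i ≤ k then V i else insert φ (V k), by simpa using h0,
      fun i hi => ?_, by simp⟩
    rcases (Nat.le_of_lt_succ hi).eq_or_lt with rfl | hi
    · exact ⟨φ, by simpa using hφ, by simp⟩
    · simpa [hi.le, Nat.succ_le_of_lt hi] using hV i hi

theorem hasSuccessfulDerivation_of_derivable {P : TemporalProblem L} {U : L.Theory}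
    (h : Derivable P U) (hU : Terminates P U) : HasSuccessfulDerivation P := by
  obtain ⟨k, V, h0, hV, rfl⟩ := h.exists_sequence
  exact ⟨k, V, h0, hV, hU⟩

/-- All formulas that occur in the universal parts of derivations from `P`. -/
def saturation (P : TemporalProblem L) : L.Theory :=
  {φ | ∃ U, Derivable P U ∧ φ ∈ U}

theorem univ_subset_saturation (P : TemporalProblem L) :
    (P.univ : Set L.Sentence) ⊆ saturation P :=
  fun _ h => ⟨_, .base, h⟩

theorem exists_derivable_of_finset {P : TemporalProblem L} (T : Finset L.Sentence)
    (h : (T : Set L.Sentence) ⊆ saturation P) : ∃ U, Derivable P U ∧ (T : Set L.Sentence) ⊆ U := by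
  classical
  induction T using Finset.induction_on with
  | empty => exact ⟨_, .base, by simp⟩
  | insert φ T _ ih =>
    rw [Finset.coe_insert, Set.insert_subset_iff] at h
    obtain ⟨U, hU, hTU⟩ := ih h.2
    obtain ⟨⟨U', hU', hφ⟩, -⟩ := h
    refine ⟨U ∪ U', hU.union hU', ?_⟩
    rw [Finset.coe_insert, Set.insert_subset_iff]
    exact ⟨Or.inr hφ, hTU.trans Set.subset_union_left⟩

/-- Compactness: finitely many members of the saturation suffice, and merging their derivations puts
them into one universal part. -/
theorem exists_derivable_entails_union {P : TemporalProblem L} {T : L.Theory} {φ : L.Sentence}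
    (h : Entails (n := 0) (saturation P ∪ T) φ) :
    ∃ U, Derivable P U ∧ Entails (n := 0) (U ∪ T) φ := by
  classical
  obtain ⟨T₀, hT₀, hφ⟩ := Theory.models_iff_finset_models.1 h
  obtain ⟨U, hU, hT₀U⟩ := exists_derivable_of_finset (P := P) (T₀.filter (· ∈ saturation P))
    (fun φ hφ => (Finset.mem_filter.1 hφ).2)
  have hφ : Entails (n := 0) (T₀ : L.Theory) φ := hφ
  refine ⟨U, hU, hφ.mono fun ψ hψ => ?_⟩
  by_cases hs : ψ ∈ saturation P
  · exact Or.inl (hT₀U (Finset.mem_coe.2 (Finset.mem_filter.2 ⟨hψ, hs⟩)))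
  · exact Or.inr ((hT₀ hψ).resolve_left hs)

theorem exists_derivable_entails {P : TemporalProblem L} {φ : L.Sentence}
    (h : Entails (n := 0) (saturation P) φ) : ∃ U, Derivable P U ∧ Entails (n := 0) U φ := by
  rw [← Set.union_empty (saturation P)] at h
  obtain ⟨U, hU, h⟩ := exists_derivable_entails_union h
  exact ⟨U, hU, by rwa [Set.union_empty] at h⟩

/-- Loop side conditions are a finite family of entailments; all must hold over the same universal
part before the rule can be applied. -/
theorem exists_derivable_forall_entails {P : TemporalProblem L} (φs : List L.Sentence)
    (h : ∀ φ ∈ φs, Entails (n := 0) (saturation P) φ) :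
    ∃ U, Derivable P U ∧ ∀ φ ∈ φs, Entails (n := 0) U φ := by
  induction φs with
  | nil => exact ⟨_, .base, by simp⟩
  | cons φ φs ih =>
    obtain ⟨U, hU, h₁⟩ := ih fun ψ hψ => h ψ (List.mem_cons_of_mem _ hψ)
    obtain ⟨U', hU', h₂⟩ := exists_derivable_entails (h φ List.mem_cons_self)
    refine ⟨U ∪ U', hU.union hU', fun ψ hψ => ?_⟩
    rcases List.mem_cons.1 hψ with rfl | hψ
    · exact h₂.mono Set.subset_union_right
    · exact (h₁ ψ hψ).mono Set.subset_union_left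

theorem hasSuccessfulDerivation_of_terminates {P : TemporalProblem L}
    (h : Terminates P (saturation P)) : HasSuccessfulDerivation P := by
  cases h with
  | initial h =>
    obtain ⟨U, hU, h⟩ := exists_derivable_entails_union h
    exact hasSuccessfulDerivation_of_derivable hU (.initial h)
  | eventuality l hl h =>
    obtain ⟨U, hU, h⟩ := exists_derivable_entails h
    exact hasSuccessfulDerivation_of_derivable hU (.eventuality l hl h)
  | groundEventuality l hl h =>
    obtain ⟨U, hU, h⟩ := exists_derivable_entails h
    exact hasSuccessfulDerivation_of_derivable hU (.groundEventuality l hl h)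

theorem mem_saturation_of_infers {P : TemporalProblem L} {φ : L.Sentence}
    (h : Infers P (saturation P) φ) : φ ∈ saturation P := by
  suffices ∃ U, Derivable P U ∧ Infers P U φ by
    obtain ⟨U, hU, h⟩ := this
    exact ⟨_, hU.step h, Set.mem_insert _ _⟩
  cases h with
  | stepResolution m hm h =>
    obtain ⟨U, hU, h⟩ := exists_derivable_entails_union h
    exact ⟨U, hU, .stepResolution m hm h⟩
  | eventualityResolution fs hfs l hl h =>
    obtain ⟨U, hU, hU'⟩ := exists_derivable_forall_entails (P := P)
      (fs.map (fun f => ((f.merged.B ⊓ f.Bx).imp (UnaryLit.atX l).not).all) ++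
        fs.map (fun f => ((f.merged.B ⊓ f.Bx).imp (disj (fs.map fun g => g.merged.A ⊓ g.Ax))).all))
      (by
        simp only [List.mem_append, List.mem_map]
        rintro _ (⟨f, hf, rfl⟩ | ⟨f, hf, rfl⟩)
        · exact (h f hf).1
        · exact (h f hf).2)
    simp only [List.mem_append, List.mem_map] at hU'
    exact ⟨U, hU, .eventualityResolution fs hfs l hl fun f hf =>
      ⟨hU' _ (.inl ⟨f, hf, rfl⟩), hU' _ (.inr ⟨f, hf, rfl⟩)⟩⟩
  | groundEventualityResolution ms hms l hl h =>
    obtain ⟨U, hU, hU'⟩ := exists_derivable_forall_entails (P := P)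
      (ms.map (fun m => m.B.imp l.form.not) ++
        ms.map (fun m => m.B.imp (disj (ms.map fun m' => m'.A))))
      (by
        simp only [List.mem_append, List.mem_map]
        rintro _ (⟨m, hm, rfl⟩ | ⟨m, hm, rfl⟩)
        · exact (h m hm).1
        · exact (h m hm).2)
    simp only [List.mem_append, List.mem_map] at hU'
    exact ⟨U, hU, .groundEventualityResolution ms hms l hl fun m hm =>
      ⟨hU' _ (.inl ⟨m, hm, rfl⟩), hU' _ (.inr ⟨m, hm, rfl⟩)⟩⟩

end Saturation

/-! ### Successor models -/

section Successors

variable {L : FirstOrder.Language.{0, 0}}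

namespace TemporalProblem

open Classical in
/-- Finitely many derived and ground step clauses that represent all of them. -/
noncomputable def clauseReps (P : TemporalProblem L) : List (DerivedClause L) :=
  (P.stepUnary.powerset.filter (· ≠ ∅)).toList.map (fun F => .univ F.toList) ++
    (P.stepUnary.powerset.filter (· ≠ ∅)).toList.map (fun F => .exist F.toList) ++
    (P.stepUnary ×ˢ P.consts).toList.map (fun p => .const p.1 p.2) ++
    P.stepGround.toList.map .ground

theorem of_mem_clauseReps {P : TemporalProblem L} {d : DerivedClause L} (h : d ∈ P.clauseReps) :
    d.Of P := by
  simp only [clauseReps, List.mem_append, List.mem_map, Finset.mem_toList, Finset.mem_filter,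
    Finset.mem_powerset, Finset.mem_product] at h
  rcases h with ((⟨F, ⟨hF, hne⟩, rfl⟩ | ⟨F, ⟨hF, hne⟩, rfl⟩) | ⟨p, hp, rfl⟩) | ⟨s, hs, rfl⟩
  · exact ⟨by simpa using hne, fun s hs => hF (Finset.mem_toList.1 hs)⟩
  · exact ⟨by simpa using hne, fun s hs => hF (Finset.mem_toList.1 hs)⟩
  · exact hp
  · exact hs

theorem univ_mem_clauseReps {P : TemporalProblem L} {F : Finset (UnaryLit L × UnaryLit L)}
    (hF : F ⊆ P.stepUnary) (hne : F ≠ ∅) : DerivedClause.univ F.toList ∈ P.clauseReps := by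
  simp only [clauseReps, List.mem_append, List.mem_map, Finset.mem_toList, Finset.mem_filter,
    Finset.mem_powerset]
  exact .inl (.inl (.inl ⟨F, ⟨hF, hne⟩, rfl⟩))

theorem exist_mem_clauseReps {P : TemporalProblem L} {F : Finset (UnaryLit L × UnaryLit L)}
    (hF : F ⊆ P.stepUnary) (hne : F ≠ ∅) : DerivedClause.exist F.toList ∈ P.clauseReps := by
  simp only [clauseReps, List.mem_append, List.mem_map, Finset.mem_toList, Finset.mem_filter,
    Finset.mem_powerset]
  exact .inl (.inl (.inr ⟨F, ⟨hF, hne⟩, rfl⟩))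

theorem const_mem_clauseReps {P : TemporalProblem L} {s : UnaryLit L × UnaryLit L}
    (hs : s ∈ P.stepUnary) {c : L.Constants} (hc : c ∈ P.consts) :
    DerivedClause.const s c ∈ P.clauseReps := by
  simp only [clauseReps, List.mem_append, List.mem_map, Finset.mem_toList, Finset.mem_product]
  exact .inl (.inr ⟨(s, c), ⟨hs, hc⟩, rfl⟩)

theorem ground_mem_clauseReps {P : TemporalProblem L} {s : PropLit L × PropLit L}
    (hs : s ∈ P.stepGround) : DerivedClause.ground s ∈ P.clauseReps := by
  simp only [clauseReps, List.mem_append, List.mem_map, Finset.mem_toList]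
  exact .inr ⟨s, hs, rfl⟩

/-- The structure `B` may follow the structure `A`, as far as the derived and the ground step
clauses are concerned. -/
def Succ (P : TemporalProblem L) (A B : Type) [L.Structure A] [L.Structure B] : Prop :=
  ∀ d ∈ P.clauseReps, d.LhsTrue A → d.RhsTrue B

/-- The element `b` may follow the element `a`, as far as the non-ground step clauses are
concerned. -/
def ElemSucc (P : TemporalProblem L) {A B : Type} [L.Structure A] [L.Structure B] (a : A) (b : B) :
    Prop :=
  ∀ s ∈ P.stepUnary, UnaryLit.TrueAt s.1 a → UnaryLit.TrueAt s.2 b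

/-- Apply the existential derived clause to all step clauses that fire at `a`; if none fires, any
element will do. -/
theorem Succ.forth {P : TemporalProblem L} {A B : Type} [L.Structure A] [L.Structure B]
    [Nonempty B] (h : P.Succ A B) (a : A) : ∃ b : B, P.ElemSucc a b := by
  classical
  by_cases hF : P.stepUnary.filter (fun s => UnaryLit.TrueAt s.1 a) = ∅
  · exact ⟨Classical.arbitrary B, fun s hs hsa =>
      absurd (Finset.mem_filter.2 ⟨hs, hsa⟩) (hF ▸ Finset.notMem_empty s)⟩
  · obtain ⟨b, hb⟩ := h _ (exist_mem_clauseReps (Finset.filter_subset _ _) hF)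
      ⟨a, fun s hs => (Finset.mem_filter.1 (Finset.mem_toList.1 hs)).2⟩
    exact ⟨b, fun s hs hsa => hb s (Finset.mem_toList.2 (Finset.mem_filter.2 ⟨hs, hsa⟩))⟩

/-- If no `a` precedes `b`, each `a` fires a step clause whose right side fails at `b`. The
universal derived clause of all clauses failing at `b` then gives a contradiction. -/
theorem Succ.back {P : TemporalProblem L} {A B : Type} [L.Structure A] [L.Structure B]
    [Nonempty A] (h : P.Succ A B) (b : B) : ∃ a : A, P.ElemSucc a b := by
  classical
  by_contra! hno
  simp only [ElemSucc, not_forall] at hno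
  let F := P.stepUnary.filter fun s => ¬ UnaryLit.TrueAt s.2 b
  have hmem : ∀ a : A, ∃ s ∈ F.toList, UnaryLit.TrueAt s.1 a := fun a => by
    obtain ⟨s, hs, hsa, hsb⟩ := hno a
    exact ⟨s, Finset.mem_toList.2 (Finset.mem_filter.2 ⟨hs, hsb⟩), hsa⟩
  have hF : F ≠ ∅ := by
    obtain ⟨s, hs, -⟩ := hmem (Classical.arbitrary A)
    exact Finset.ne_empty_of_mem (Finset.mem_toList.1 hs)
  obtain ⟨s, hs, hsb⟩ := h _ (univ_mem_clauseReps (Finset.filter_subset _ _) hF) hmem b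
  exact (Finset.mem_filter.1 (Finset.mem_toList.1 hs)).2 hsb

theorem Succ.elemSucc_const {P : TemporalProblem L} {A B : Type} [L.Structure A] [L.Structure B]
    (h : P.Succ A B) {c : L.Constants} (hc : c ∈ P.consts) : P.ElemSucc (c : A) (c : B) :=
  fun _ hs => h _ (const_mem_clauseReps hs hc)

open Classical in
/-- The merged clause made up of all clauses whose left-hand side is true in `A`. -/
noncomputable def firing (P : TemporalProblem L) (A : Type) [L.Structure A] : MergedClause L :=
  ⟨P.clauseReps.filter fun d => d.LhsTrue A⟩

open Classical in
/-- The full merged clause made up of all clauses that apply to the element `a` of `A`. -/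
noncomputable def fullFiring (P : TemporalProblem L) {A : Type} [L.Structure A] (a : A) :
    FullClause L :=
  ⟨P.firing A, (P.stepUnary.filter fun s => UnaryLit.TrueAt s.1 a).toList⟩

theorem mem_firing_parts {P : TemporalProblem L} {A : Type} [L.Structure A]
    {d : DerivedClause L} : d ∈ (P.firing A).parts ↔ d ∈ P.clauseReps ∧ d.LhsTrue A := by
  simp [firing]

theorem mem_fullFiring_steps {P : TemporalProblem L} {A : Type} [L.Structure A] {a : A}
    {s : UnaryLit L × UnaryLit L} :
    s ∈ (P.fullFiring a).steps ↔ s ∈ P.stepUnary ∧ UnaryLit.TrueAt s.1 a := by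
  simp [fullFiring]

theorem firing_of {P : TemporalProblem L} {A : Type} [L.Structure A]
    (h : (P.firing A).parts ≠ []) : (P.firing A).Of P :=
  ⟨h, fun _ hd => of_mem_clauseReps (mem_firing_parts.1 hd).1⟩

theorem fullFiring_of {P : TemporalProblem L} {A : Type} [L.Structure A] {a : A}
    (h : (P.firing A).parts ≠ []) : (P.fullFiring a).Of P :=
  ⟨firing_of h, fun _ hs => (mem_fullFiring_steps.1 hs).1⟩

theorem realize_firing_A (P : TemporalProblem L) (A : Type) [L.Structure A] {n : ℕ}
    (v : Empty → A) (xs : Fin n → A) : (P.firing A).A.Realize v xs :=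
  (MergedClause.realize_A _ _ _).2 fun _ hd => (mem_firing_parts.1 hd).2

theorem realize_firing_B {P : TemporalProblem L} {A B : Type} [L.Structure A] [L.Structure B]
    {n : ℕ} (v : Empty → B) (xs : Fin n → B) :
    (P.firing A).B.Realize v xs ↔ P.Succ A B := by
  rw [MergedClause.realize_B]
  simp only [mem_firing_parts, and_imp, Succ]

theorem realize_fullFiring_Ax {P : TemporalProblem L} {A : Type} [L.Structure A]
    (v : Empty → A) (xs : Fin 0 → A) (a : A) :
    (P.fullFiring a).Ax.Realize v (Fin.snoc xs a : Fin 1 → A) :=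
  (FullClause.realize_Ax _ _ _ _).2 fun _ hs => (mem_fullFiring_steps.1 hs).2

theorem realize_fullFiring_Bx {P : TemporalProblem L} {A B : Type} [L.Structure A]
    [L.Structure B] {a : A} (v : Empty → B) (xs : Fin 0 → B) (b : B) :
    (P.fullFiring a).Bx.Realize v (Fin.snoc xs b : Fin 1 → B) ↔ P.ElemSucc a b := by
  rw [FullClause.realize_Bx]
  simp only [mem_fullFiring_steps, ElemSucc, and_imp]

/-- Merged clauses must be nonempty, so models in which nothing fires need separate treatment: every
structure may follow them. -/
theorem succ_of_parts_eq_nil {P : TemporalProblem L} {A : Type} [L.Structure A]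
    (h : (P.firing A).parts = []) (B : Type) [L.Structure B] : P.Succ A B := by
  rw [← realize_firing_B (default : Empty → B) (default : Fin 0 → B), MergedClause.realize_B, h]
  simp

theorem elemSucc_of_parts_eq_nil {P : TemporalProblem L} {A : Type} [L.Structure A]
    (h : (P.firing A).parts = []) (a : A) {B : Type} [L.Structure B] (b : B) :
    P.ElemSucc a b := by
  classical
  intro s hs hsa
  -- A step clause firing at `a` would make its one-clause existential derived clause fire. The
  -- detour through `toFinset` matches the form of the representatives.
  have : DerivedClause.exist [s].toFinset.toList ∈ (P.firing A).parts :=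
    mem_firing_parts.2 ⟨exist_mem_clauseReps (by simpa using hs) (by simp),
      ⟨a, by simpa using hsa⟩⟩
  rw [h] at this
  exact absurd this List.not_mem_nil

/-- The models are infinitely many but a loop is a finite list; each firing clause is a sublist of
the fixed list of representatives. -/
theorem finite_range_firing (P : TemporalProblem L) {ι : Type*} (A : ι → Type)
    [∀ i, L.Structure (A i)] : (Set.range fun i => P.firing (A i)).Finite := by
  refine ((List.finite_toSet P.clauseReps.sublists).image MergedClause.mk).subset ?_
  rintro _ ⟨i, rfl⟩
  exact ⟨_, List.mem_sublists.2 List.filter_sublist, rfl⟩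

theorem finite_range_fullFiring (P : TemporalProblem L) {ι : Type*} (A : ι → Type)
    [∀ i, L.Structure (A i)] : (Set.range fun x : Σ i, A i => P.fullFiring x.2).Finite := by
  refine ((P.finite_range_firing A).image2 FullClause.mk
    (P.stepUnary.powerset.finite_toSet.image Finset.toList)).subset ?_
  classical
  rintro _ ⟨⟨i, a⟩, rfl⟩
  exact ⟨_, ⟨i, rfl⟩, _, ⟨_, Finset.mem_coe.2 (Finset.mem_powerset.2 (Finset.filter_subset _ _)),
    rfl⟩, rfl⟩

/-! ### What closure under the rules means for models of the saturation. -/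

/-- The successor relation of models of the saturation. -/
def ModelSucc (P : TemporalProblem L) (A B : (saturation P).ModelType) : Prop :=
  P.Succ A B

/-- The successor relation of elements of models of the saturation. -/
def PointSucc (P : TemporalProblem L) (x y : Σ A : (saturation P).ModelType, A) : Prop :=
  P.Succ x.1 y.1 ∧ P.ElemSucc x.2 y.2

theorem realize_of_mem {T : L.Theory} (A : T.ModelType) {φ : L.Sentence} (h : φ ∈ T) :
    BoundedFormula.Realize φ (default : Empty → A) default :=
  Theory.realize_sentence_of_mem T h

/-- A model of the saturation satisfying the firing right sides is a successor. If there is none,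
step resolution puts the negated left side into the saturation, yet it is true in `A`. -/
theorem exists_modelSucc (P : TemporalProblem L) (A : (saturation P).ModelType) :
    ∃ B, P.ModelSucc A B := by
  by_cases h : (P.firing A).parts = []
  · exact ⟨A, succ_of_parts_eq_nil h A⟩
  by_contra! hno
  refine realize_of_mem A (mem_saturation_of_infers (.stepResolution _ (firing_of h) ?_))
    (P.realize_firing_A A _ _)
  intro M v xs
  refine absurd ?_ (hno (M.subtheoryModel Set.subset_union_left))
  exact (realize_firing_B (B := M) default default).1 (realize_of_mem M (Or.inr rfl))

theorem exists_modelSucc_ground {P : TemporalProblem L} (hP : ¬ Terminates P (saturation P))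
    {l : GroundLit L} (hl : l ∈ P.evGround) (A : (saturation P).ModelType) :
    ∃ B : (saturation P).ModelType, l.TrueIn B ∧ Relation.TransGen P.ModelSucc A B := by
  by_contra! hno
  -- `R` contains `A`, where `l` may be true; only proper successors of members of `R` must falsify
  -- `l`, and the loop conditions concern only these.
  let R := {B | Relation.ReflTransGen P.ModelSucc A B}
  have hstep : ∀ B ∈ R, ∀ C : (saturation P).ModelType, P.Succ B C → C ∈ R ∧ ¬ l.TrueIn C :=
    fun B hB C h => ⟨hB.tail h, fun hC => hno C hC (.tail' hB h)⟩
  -- If nothing fired in a reachable `B`, every model would follow `B` and falsify `l`, and the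
  -- termination rule would apply.
  have hne : ∀ B ∈ R, (P.firing B).parts ≠ [] := fun B hB h =>
    hP (.groundEventuality l hl fun M v xs hM =>
      (hstep B hB M (succ_of_parts_eq_nil h M)).2 ((GroundLit.realize_form l v xs).1 hM))
  have hfin : ((fun B : (saturation P).ModelType => P.firing B) '' R).Finite :=
    (P.finite_range_firing fun B : (saturation P).ModelType => B).subset (Set.image_subset_range _ _)
  let ms := hfin.toFinset.toList
  -- The clauses firing in reachable models form a ground loop: a model of one of their right sides
  -- is itself reachable, so its own firing clause is in the list.
  have hms : ∀ m, m ∈ ms ↔ ∃ B ∈ R, P.firing B = m := fun m => by simp [ms]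
  have hinf := realize_of_mem A (mem_saturation_of_infers
    (.groundEventualityResolution ms (fun m hm => ?_) l hl fun m hm => ?_))
  · exact (realize_conj_map ms _ _ _).1 hinf _ ((hms _).2 ⟨A, .refl, rfl⟩)
      (P.realize_firing_A A _ _)
  · obtain ⟨B, hB, rfl⟩ := (hms m).1 hm
    exact firing_of (hne B hB)
  · obtain ⟨B, hB, rfl⟩ := (hms m).1 hm
    refine ⟨fun M v xs hM hl => ?_, fun M v xs hM => ?_⟩
    · exact (hstep B hB M ((realize_firing_B v xs).1 hM)).2 ((GroundLit.realize_form l v xs).1 hl)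
    · exact (realize_disj_map ms _ _ _).2 ⟨P.firing M,
        (hms _).2 ⟨M, (hstep B hB M ((realize_firing_B v xs).1 hM)).1, rfl⟩,
        P.realize_firing_A M _ _⟩

/-- The same loop argument for pairs of a model and an element, with full merged clauses recording
also the step clauses that fire at the element. -/
theorem exists_pointSucc_unary {P : TemporalProblem L} (hP : ¬ Terminates P (saturation P))
    {l : UnaryLit L} (hl : l ∈ P.evUnary) (x : Σ A : (saturation P).ModelType, A) :
    ∃ y : Σ A : (saturation P).ModelType, A,
      UnaryLit.TrueAt l y.2 ∧ Relation.TransGen P.PointSucc x y := by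
  by_contra! hno
  let R := {y | Relation.ReflTransGen P.PointSucc x y}
  have hstep : ∀ y ∈ R, ∀ z : Σ A : (saturation P).ModelType, A, P.PointSucc y z →
      z ∈ R ∧ ¬ UnaryLit.TrueAt l z.2 :=
    fun y hy z h => ⟨hy.tail h, fun hz => hno z hz (.tail' hy h)⟩
  have hne : ∀ y ∈ R, (P.firing y.1).parts ≠ [] := fun y hy h =>
    hP (.eventuality l hl fun M v xs a ha =>
      (hstep y hy ⟨M, a⟩ ⟨succ_of_parts_eq_nil h M, elemSucc_of_parts_eq_nil h y.2 a⟩).2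
        ((UnaryLit.realize_atX l v xs a).1 ha))
  have hfin : ((fun y : Σ A : (saturation P).ModelType, A => P.fullFiring y.2) '' R).Finite :=
    (P.finite_range_fullFiring fun B : (saturation P).ModelType => B).subset
      (Set.image_subset_range _ _)
  let fs := hfin.toFinset.toList
  have hfs : ∀ f, f ∈ fs ↔ ∃ y ∈ R, P.fullFiring y.2 = f := fun f => by simp [fs]
  have hsucc : ∀ (y : Σ A : (saturation P).ModelType, A) (M : (saturation P).ModelType)
      (v : Empty → M) (xs : Fin 0 → M) (a : M),
      ((P.fullFiring y.2).merged.B ⊓ (P.fullFiring y.2).Bx).Realize v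
        (Fin.snoc xs a : Fin 1 → M) → P.PointSucc y ⟨M, a⟩ := fun y M v xs a h => by
    rw [BoundedFormula.realize_inf] at h
    exact ⟨(realize_firing_B _ _).1 h.1, (realize_fullFiring_Bx _ _ _).1 h.2⟩
  have hinf := realize_of_mem x.1 (mem_saturation_of_infers
    (.eventualityResolution fs (fun f hf => ?_) l hl fun f hf => ?_))
  · have h := (realize_conj_map fs _ _ _).1 (BoundedFormula.realize_all.1 hinf x.2) _
      ((hfs _).2 ⟨x, .refl, rfl⟩)
    rw [BoundedFormula.realize_sup, BoundedFormula.realize_not, BoundedFormula.realize_not] at h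
    exact h.elim (fun h => h (P.realize_firing_A x.1 _ _)) fun h =>
      h (realize_fullFiring_Ax _ _ _)
  · obtain ⟨y, hy, rfl⟩ := (hfs f).1 hf
    exact fullFiring_of (hne y hy)
  · obtain ⟨y, hy, rfl⟩ := (hfs f).1 hf
    refine ⟨fun M v xs a hM hl => ?_, fun M v xs a hM => ?_⟩
    · exact (hstep y hy ⟨M, a⟩ (hsucc y M v xs a hM)).2 ((UnaryLit.realize_atX l v xs a).1 hl)
    · refine (realize_disj_map fs _ _ _).2 ⟨P.fullFiring a,
        (hfs _).2 ⟨⟨M, a⟩, (hstep y hy ⟨M, a⟩ (hsucc y M v xs a hM)).1, rfl⟩, ?_⟩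
      rw [BoundedFormula.realize_inf]
      exact ⟨P.realize_firing_A M _ _, realize_fullFiring_Ax _ _ _⟩

end TemporalProblem

end Successors

/-! ### Temporal models -/

section TemporalModels

variable {L : FirstOrder.Language.{0, 0}}

theorem TemporalStructure.holds_conj (M : TemporalStructure L) {n : ℕ} (t : ℕ)
    (φs : List (TFormula L n)) (xs : Fin n → M.D) :
    M.Holds t (TFormula.conj φs) xs ↔ ∀ φ ∈ φs, M.Holds t φ xs := by
  induction φs with
  | nil =>
    let := M.interp t
    simp only [List.not_mem_nil, false_imp_iff, implies_true, iff_true]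
    exact BoundedFormula.realize_top.2 trivial
  | cons φ φs ih =>
    rw [List.forall_mem_cons, ← ih]
    rfl

/-- The temporal structure `M` satisfies the clauses of the problem `P`. -/
structure TemporalStructure.IsModel (M : TemporalStructure L) (P : TemporalProblem L) : Prop where
  init : ∀ φ ∈ P.init,
    @BoundedFormula.Realize L M.D (M.interp 0) Empty _ φ default (default : Fin 0 → M.D)
  univ : ∀ t, ∀ φ ∈ P.univ,
    @BoundedFormula.Realize L M.D (M.interp t) Empty _ φ default (default : Fin 0 → M.D)
  stepGround : ∀ t, ∀ s ∈ P.stepGround,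
    @PropLit.TrueIn L M.D (M.interp t) s.1 → @PropLit.TrueIn L M.D (M.interp (t + 1)) s.2
  stepUnary : ∀ t, ∀ s ∈ P.stepUnary, ∀ d : M.D,
    @UnaryLit.TrueAt L M.D (M.interp t) s.1 d → @UnaryLit.TrueAt L M.D (M.interp (t + 1)) s.2 d
  evGround : ∀ t, ∀ l ∈ P.evGround, ∃ s, t ≤ s ∧ @GroundLit.TrueIn L M.D (M.interp s) l
  evUnary : ∀ t, ∀ l ∈ P.evUnary, ∀ d : M.D, ∃ s, t ≤ s ∧ @UnaryLit.TrueAt L M.D (M.interp s) l d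

theorem TemporalStructure.holds_formula_iff (M : TemporalStructure L) (P : TemporalProblem L) :
    M.Holds 0 P.formula Fin.elim0 ↔ M.IsModel P := by
  have := M.nonempty
  have hprop : ∀ (t : ℕ) (l : PropLit L) (xs : Fin 1 → M.D),
      M.Holds t (.fo (PropLit.form l)) xs ↔ @PropLit.TrueIn L M.D (M.interp t) l :=
    fun t l xs => @PropLit.realize_form L M.D (M.interp t) 1 l default xs
  have hground : ∀ (t : ℕ) (l : GroundLit L) (xs : Fin 1 → M.D),
      M.Holds t (.fo l.form) xs ↔ @GroundLit.TrueIn L M.D (M.interp t) l :=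
    fun t l xs => @GroundLit.realize_form L M.D (M.interp t) 1 l default xs
  have hunary : ∀ (t : ℕ) (l : UnaryLit L) (xs : Fin 0 → M.D) (d : M.D),
      M.Holds t (.fo (UnaryLit.atX l)) (Fin.snoc xs d : Fin 1 → M.D) ↔
        @UnaryLit.TrueAt L M.D (M.interp t) l d :=
    fun t l xs d => @UnaryLit.realize_atX L M.D (M.interp t) 0 l default xs d
  have hdef : (Fin.elim0 : Fin 0 → M.D) = default := Subsingleton.elim _ _
  have hstep : ∀ (t : ℕ) (xs : Fin 0 → M.D), M.Holds t (.all (TFormula.conj P.stepFormulas)) xs ↔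
      (∀ s ∈ P.stepGround, @PropLit.TrueIn L M.D (M.interp t) s.1 →
        @PropLit.TrueIn L M.D (M.interp (t + 1)) s.2) ∧
      ∀ s ∈ P.stepUnary, ∀ d : M.D, @UnaryLit.TrueAt L M.D (M.interp t) s.1 d →
        @UnaryLit.TrueAt L M.D (M.interp (t + 1)) s.2 d := by
    intro t xs
    simp only [Holds.eq_4, Holds.eq_3, Holds.eq_5, holds_conj, TemporalProblem.stepFormulas,
      List.forall_mem_append, List.forall_mem_map, Finset.mem_toList, hprop, hunary, forall_and,
      forall_const]
    exact and_congr_right fun _ => ⟨fun h s hs d => h d s hs, fun h d s hs => h s hs d⟩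
  have hev : ∀ (t : ℕ) (xs : Fin 0 → M.D), M.Holds t (.all (TFormula.conj P.evFormulas)) xs ↔
      (∀ l ∈ P.evGround, ∃ s, t ≤ s ∧ @GroundLit.TrueIn L M.D (M.interp s) l) ∧
      ∀ l ∈ P.evUnary, ∀ d : M.D, ∃ s, t ≤ s ∧ @UnaryLit.TrueAt L M.D (M.interp s) l d := by
    intro t xs
    simp only [Holds.eq_4, Holds.eq_6, holds_conj, TemporalProblem.evFormulas,
      List.forall_mem_append, List.forall_mem_map, Finset.mem_toList, hground, hunary, forall_and,
      forall_const]
    exact and_congr_right fun _ => ⟨fun h s hs d => h d s hs, fun h d s hs => h s hs d⟩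
  simp only [TemporalProblem.formula, Holds.eq_1, Holds.eq_2, Holds.eq_7, hstep, hev, holds_conj,
    List.forall_mem_map, Finset.mem_toList, hdef, Nat.zero_le, forall_const, forall_and]
  exact ⟨fun h => ⟨h.1, h.2.1, h.2.2.1.1, h.2.2.1.2, h.2.2.2.1, h.2.2.2.2⟩,
    fun h => ⟨h.init, h.univ, ⟨h.stepGround, h.stepUnary⟩, h.evGround, h.evUnary⟩⟩

/-- The interpretation of the symbols on `D` for which `f : D → A` reflects and preserves the
predicates, with given constants. -/
@[reducible]
def pullbackStructure (hL : ∀ n : ℕ, IsEmpty (L.Functions (n + 1))) {D A : Type} [L.Structure A]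
    (cst : L.Constants → D) (f : D → A) : L.Structure D where
  funMap {n} := match n with
    | 0 => fun c _ => cst c
    | n + 1 => fun g => (hL n).elim g
  RelMap R xs := Structure.RelMap R (f ∘ xs)

theorem pullbackStructure_constantMap (hL : ∀ n : ℕ, IsEmpty (L.Functions (n + 1))) {D A : Type}
    [L.Structure A] (cst : L.Constants → D) (f : D → A) (c : L.Constants) :
    @constantMap L D (pullbackStructure hL cst f) c = cst c := rfl

theorem pullbackStructure_unary (hL : ∀ n : ℕ, IsEmpty (L.Functions (n + 1))) {D A : Type}
    [L.Structure A] (cst : L.Constants → D) (f : D → A) (l : UnaryLit L) (d : D) :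
    @UnaryLit.TrueAt L D (pullbackStructure hL cst f) l d ↔ UnaryLit.TrueAt l (f d) := by
  have : f ∘ ![d] = ![f d] := funext fun i => by fin_cases i; rfl
  unfold UnaryLit.TrueAt
  rw [← this]
  rfl

theorem pullbackStructure_prop (hL : ∀ n : ℕ, IsEmpty (L.Functions (n + 1))) {D A : Type}
    [L.Structure A] (cst : L.Constants → D) (f : D → A) (l : PropLit L) :
    @PropLit.TrueIn L D (pullbackStructure hL cst f) l ↔ PropLit.TrueIn A l := by
  have : f ∘ ![] = ![] := Subsingleton.elim _ _
  unfold PropLit.TrueIn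
  rw [← this]
  rfl

theorem pullbackStructure_ground (hL : ∀ n : ℕ, IsEmpty (L.Functions (n + 1))) {D A : Type}
    [L.Structure A] (cst : L.Constants → D) (f : D → A) (l : GroundLit L)
    (hc : ∀ c ∈ l.consts, f (cst c) = (c : A)) :
    @GroundLit.TrueIn L D (pullbackStructure hL cst f) l ↔ GroundLit.TrueIn A l := by
  cases l with
  | prop l => exact pullbackStructure_prop hL cst f l
  | const l c =>
    rw [GroundLit.TrueIn, GroundLit.TrueIn, pullbackStructure_unary,
      pullbackStructure_constantMap, hc c (Finset.mem_singleton_self c)]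

/-- Distinct runs may share a value, so `f` need not be injective; this is where the absence of
equality matters. -/
theorem pullbackStructure_realize (hL : ∀ n : ℕ, IsEmpty (L.Functions (n + 1))) {D A : Type}
    [L.Structure A] (cst : L.Constants → D) (f : D → A) (hf : Function.Surjective f)
    {φ : L.Sentence} (hφ : EqFree φ) (hc : ∀ c ∈ formulaConsts φ, f (cst c) = (c : A)) :
    @BoundedFormula.Realize L D (pullbackStructure hL cst f) Empty _ φ default default ↔
      BoundedFormula.Realize φ (default : Empty → A) default := by
  let := pullbackStructure hL cst f
  rw [← realize_comp_of_surjective hL f hf (fun _ _ => Iff.rfl) φ hφ hc default default,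
    Subsingleton.elim (f ∘ default) (default : Empty → A),
    Subsingleton.elim (f ∘ default) (default : Fin 0 → A)]

namespace TemporalProblem

/-! ### Constants and element types of a problem. -/

theorem formulaConsts_subset_of_mem_univ {P : TemporalProblem L} {φ : L.Sentence}
    (h : φ ∈ P.univ) : formulaConsts φ ⊆ P.consts := fun _ hc => by
  classical
  simp only [consts, Finset.mem_union, Finset.mem_biUnion]
  exact .inl (.inl ⟨φ, h, hc⟩)

theorem formulaConsts_subset_of_mem_init {P : TemporalProblem L} {φ : L.Sentence}
    (h : φ ∈ P.init) : formulaConsts φ ⊆ P.consts := fun _ hc => by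
  classical
  simp only [consts, Finset.mem_union, Finset.mem_biUnion]
  exact .inl (.inr ⟨φ, h, hc⟩)

theorem consts_subset_of_mem_evGround {P : TemporalProblem L} {l : GroundLit L}
    (h : l ∈ P.evGround) : l.consts ⊆ P.consts := fun _ hc => by
  classical
  simp only [consts, Finset.mem_union, Finset.mem_biUnion]
  exact .inr ⟨l, h, hc⟩

open Classical in
/-- The unary literals that occur in the step clauses and the eventualities. -/
noncomputable def unaryLits (P : TemporalProblem L) : Finset (UnaryLit L) :=
  P.stepUnary.image Prod.fst ∪ P.stepUnary.image Prod.snd ∪ P.evUnary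

open Classical in
/-- The literals of the problem that the element `a` satisfies. -/
noncomputable def elemType (P : TemporalProblem L) {A : Type} [L.Structure A] (a : A) :
    P.unaryLits.powerset :=
  ⟨P.unaryLits.filter fun l => UnaryLit.TrueAt l a,
    Finset.mem_powerset.2 (Finset.filter_subset _ _)⟩

theorem mem_elemType {P : TemporalProblem L} {A : Type} [L.Structure A] {a : A}
    {l : UnaryLit L} (hl : l ∈ P.unaryLits) : l ∈ (P.elemType a).1 ↔ UnaryLit.TrueAt l a := by
  simp [elemType, hl]

/-- The step relation depends only on types, which are finitely many although the models may be of
any size. -/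
theorem elemSucc_iff {P : TemporalProblem L} {A B : Type} [L.Structure A] [L.Structure B]
    {a : A} {b : B} : P.ElemSucc a b ↔
      ∀ s ∈ P.stepUnary, s.1 ∈ (P.elemType a).1 → s.2 ∈ (P.elemType b).1 := by
  classical
  refine forall₂_congr fun s hs => ?_
  rw [mem_elemType, mem_elemType]
  · exact Finset.mem_union_left _ (Finset.mem_union_right _ (Finset.mem_image_of_mem _ hs))
  · exact Finset.mem_union_left _ (Finset.mem_union_left _ (Finset.mem_image_of_mem _ hs))

theorem mem_elemType_ev {P : TemporalProblem L} {A : Type} [L.Structure A] {a : A}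
    {l : UnaryLit L} (hl : l ∈ P.evUnary) : l ∈ (P.elemType a).1 ↔ UnaryLit.TrueAt l a := by
  classical
  exact mem_elemType (Finset.mem_union_right _ hl)

/-- The models of the saturation with the types of their elements. -/
noncomputable def modelGraph (P : TemporalProblem L) :
    TypedGraph (saturation P).ModelType P.unaryLits.powerset where
  E := P.ModelSucc
  T A := Set.range fun a : A => P.elemType a
  C τ σ := ∀ s ∈ P.stepUnary, s.1 ∈ τ.1 → s.2 ∈ σ.1
  serial := P.exists_modelSucc
  forth := by
    rintro A B h _ ⟨a, rfl⟩
    obtain ⟨b, hb⟩ := Succ.forth h a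
    exact ⟨_, ⟨b, rfl⟩, elemSucc_iff.1 hb⟩
  back := by
    rintro A B h _ ⟨b, rfl⟩
    obtain ⟨a, ha⟩ := Succ.back h b
    exact ⟨_, ⟨a, rfl⟩, elemSucc_iff.1 ha⟩

/-- If no termination rule applies to the saturation, then its models can be arranged in a sequence
that respects all clauses. -/
theorem exists_model_sequence {P : TemporalProblem L} (hP : ¬ Terminates P (saturation P))
    (A : (saturation P).ModelType) :
    ∃ p : ℕ → (saturation P).ModelType, p 0 = A ∧ (∀ i, P.Succ (p i) (p (i + 1))) ∧
      (∀ l ∈ P.evGround, ∀ n, ∃ m, n < m ∧ l.TrueIn (p m)) ∧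
      ∀ n (b : p n), ∃ r : ∀ i, p i, r n = b ∧ (∀ i, P.ElemSucc (r i) (r (i + 1))) ∧
        ∀ l ∈ P.evUnary, ∀ n, ∃ m, n < m ∧ UnaryLit.TrueAt l (r m) := by
  obtain ⟨p, h0, hp, hg, hr⟩ := P.modelGraph.exists_fair_path
    (fun (l : P.evGround) => {B | l.1.TrueIn B}) (fun (l : P.evUnary) => {τ | l.1 ∈ τ.1})
    (fun l A => exists_modelSucc_ground hP l.2 A)
    (by
      rintro l A _ ⟨a, rfl⟩
      obtain ⟨y, hy, hay⟩ := exists_pointSucc_unary hP l.2 ⟨A, a⟩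
      exact ⟨y.1, P.elemType y.2, (mem_elemType_ev l.2).2 hy,
        hay.lift (fun x => (x.1, P.elemType x.2)) fun x z h =>
          ⟨h.1, ⟨x.2, rfl⟩, ⟨z.2, rfl⟩, elemSucc_iff.1 h.2⟩⟩) A
  refine ⟨p, h0, hp, fun l hl => hg ⟨l, hl⟩, fun n b => ?_⟩
  obtain ⟨τ, hτ, hrun, hev⟩ := hr n (P.elemType b) ⟨b, rfl⟩
  have hreal : ∀ i, ∃ a : p i, P.elemType a = τ i := fun i => (hrun i).1
  choose a ha using hreal
  -- Any realizations of the types along the run will do, except that the prescribed `b` must be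
  -- used at `n`.
  have hupd : ∀ i, P.elemType (Function.update a n b i) = τ i := by
    intro i
    by_cases hi : i = n
    · subst hi; rw [Function.update_self, hτ]
    · rw [Function.update_of_ne hi, ha]
  refine ⟨Function.update a n b, Function.update_self _ _ _, fun i => ?_, fun l hl k => ?_⟩
  · rw [elemSucc_iff, hupd, hupd]
    exact (hrun i).2.2
  · obtain ⟨m, hm, hlm⟩ := hev ⟨l, hl⟩ k
    exact ⟨m, hm, (mem_elemType_ev hl).1 (hupd m ▸ hlm)⟩

/-- A problem without successfully terminating derivation is satisfiable, if its ground
eventualities force its eventualities to be met by the constants. -/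
theorem satisfiable_of_not_hasSuccessfulDerivation
    (hL : ∀ n : ℕ, IsEmpty (L.Functions (n + 1))) {P : TemporalProblem L}
    (huniv : ∀ φ ∈ P.univ, EqFree φ) (hinit : ∀ φ ∈ P.init, EqFree φ)
    (hflood : ∀ l ∈ P.evUnary, ∀ c ∈ P.consts, ∃ g ∈ P.evGround,
      ∀ A : (saturation P).ModelType, g.TrueIn A → UnaryLit.TrueAt l (c : A))
    (hP : ¬ HasSuccessfulDerivation P) : P.Satisfiable := by
  classical
  have hT : ¬ Terminates P (saturation P) := fun h => hP (hasSuccessfulDerivation_of_terminates h)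
  obtain ⟨A, hA⟩ : ∃ A : (saturation P).ModelType,
      ∀ φ ∈ P.init, BoundedFormula.Realize φ (default : Empty → A) default := by
    by_contra! hno
    refine hT (.initial fun M v xs => ?_)
    obtain ⟨φ, hφ, h⟩ := hno (M.subtheoryModel Set.subset_union_left)
    exact absurd (realize_of_mem M (Or.inr hφ)) h
  obtain ⟨p, rfl, hsucc, hground, hrun⟩ := exists_model_sequence hT A
  let D := {r : ∀ i, p i // (∀ i, P.ElemSucc (r i) (r (i + 1))) ∧
    ∀ l ∈ P.evUnary, ∀ n, ∃ m, n < m ∧ UnaryLit.TrueAt l (r m)}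
  have hsurj : ∀ n, Function.Surjective fun d : D => d.1 n := fun n b => by
    obtain ⟨r, hn, hr⟩ := hrun n b
    exact ⟨⟨r, hr⟩, hn⟩
  obtain ⟨d₀, -⟩ := hsurj 0 (Classical.arbitrary (p 0))
  -- The values of a constant of the problem form a run by the derived clauses for constants, and a
  -- fair one by `hflood`. Constants outside the problem may denote any run.
  have hconst : ∀ c : L.Constants, ∃ d : D, c ∈ P.consts → ∀ i, d.1 i = (c : p i) := fun c => by
    by_cases hc : c ∈ P.consts
    · refine ⟨⟨fun i => (c : p i), fun i => (hsucc i).elemSucc_const hc, fun l hl n => ?_⟩,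
        fun _ _ => rfl⟩
      obtain ⟨g, hg, hgl⟩ := hflood l hl c hc
      obtain ⟨m, hm, hgm⟩ := hground g hg n
      exact ⟨m, hm, hgl _ hgm⟩
    · exact ⟨d₀, fun h => absurd h hc⟩
  choose cst hcst using hconst
  let M : TemporalStructure L :=
    { D := D
      nonempty := ⟨d₀⟩
      interp := fun n => pullbackStructure hL cst fun d : D => d.1 n
      rigid := fun _ _ _ => rfl }
  refine ⟨M, (M.holds_formula_iff P).2 ⟨fun φ hφ => ?_, fun t φ hφ => ?_, fun t s hs h => ?_,
    fun t s hs d h => ?_, fun t l hl => ?_, fun t l hl d => ?_⟩⟩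
  · exact (pullbackStructure_realize hL cst _ (hsurj 0) (hinit φ hφ) fun c hc =>
      hcst c (formulaConsts_subset_of_mem_init hφ hc) 0).2 (hA φ hφ)
  · exact (pullbackStructure_realize hL cst _ (hsurj t) (huniv φ hφ) fun c hc =>
      hcst c (formulaConsts_subset_of_mem_univ hφ hc) t).2
        (realize_of_mem (p t) (univ_subset_saturation P hφ))
  · exact (pullbackStructure_prop hL cst _ s.2).2
      (hsucc t _ (ground_mem_clauseReps hs) ((pullbackStructure_prop hL cst _ s.1).1 h))
  · exact (pullbackStructure_unary hL cst _ s.2 d).2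
      (d.2.1 t s hs ((pullbackStructure_unary hL cst _ s.1 d).1 h))
  · obtain ⟨m, hm, h⟩ := hground l hl t
    exact ⟨m, hm.le, (pullbackStructure_ground hL cst _ l fun c hc =>
      hcst c (consts_subset_of_mem_evGround hl hc) m).2 h⟩
  · obtain ⟨m, hm, h⟩ := d.2.2 l hl t
    exact ⟨m, hm.le, (pullbackStructure_unary hL cst _ l d).2 h⟩

theorem Satisfiable.of_subset {P Q : TemporalProblem L} (hQ : Q.Satisfiable)
    (hinit : P.init ⊆ Q.init) (huniv : P.univ ⊆ Q.univ) (hsg : P.stepGround ⊆ Q.stepGround)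
    (hsu : P.stepUnary ⊆ Q.stepUnary) (heg : P.evGround ⊆ Q.evGround)
    (heu : P.evUnary ⊆ Q.evUnary) : P.Satisfiable := by
  obtain ⟨M, hM⟩ := hQ
  have h := (M.holds_formula_iff Q).1 hM
  exact ⟨M, (M.holds_formula_iff P).2 ⟨fun φ hφ => h.init φ (hinit hφ),
    fun t φ hφ => h.univ t φ (huniv hφ), fun t s hs => h.stepGround t s (hsg hs),
    fun t s hs => h.stepUnary t s (hsu hs), fun t l hl => h.evGround t l (heg hl),
    fun t l hl => h.evUnary t l (heu hl)⟩⟩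

/-! ### Flooded problems -/

/-- Flooding adds no constants, so one round of it already covers every constant of the flooded
problem. -/
theorem consts_flooded (P : TemporalProblem L) : P.flooded.consts ⊆ P.consts := by
  classical
  intro c hc
  simp only [consts, flooded, Finset.mem_union, Finset.mem_biUnion, Finset.mem_image,
    Finset.mem_product] at hc ⊢
  rcases hc with hc | ⟨g, hg | ⟨x, ⟨-, hx⟩, rfl⟩, hc⟩
  · exact .inl hc
  · exact .inr ⟨g, hg, hc⟩
  · rw [GroundLit.consts, Finset.mem_singleton] at hc
    subst hc
    exact hx

theorem termConsts_constant_term {α : Type} (c : L.Constants) :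
    termConsts (c.term : L.Term α) = {c} := by
  simp [Constants.term, termConsts]

theorem formulaConsts_renaming (q : L.Relations 0) (l : UnaryLit L) (c : L.Constants) :
    formulaConsts ((PropLit.form ⟨true, q⟩ : L.BoundedFormula Empty 0).imp
      (UnaryLit.at l c.term)) ⊆ {c} := by
  unfold PropLit.form UnaryLit.at
  cases l.sign <;>
    simp [formulaConsts, Relations.boundedFormula, Relations.boundedFormula₁,
      BoundedFormula.not, termConsts_constant_term]

theorem consts_floodedRenamed (P : TemporalProblem L)
    (name : UnaryLit L → L.Constants → L.Relations 0) :
    (P.floodedRenamed name).consts ⊆ P.consts := by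
  classical
  intro c hc
  simp only [consts, floodedRenamed, Finset.mem_union, Finset.mem_biUnion, Finset.mem_image,
    Finset.mem_product] at hc ⊢
  rcases hc with (⟨φ, hφ | ⟨x, ⟨-, hx⟩, rfl⟩, hc⟩ | hc) | ⟨g, hg | ⟨x, -, rfl⟩, hc⟩
  · exact .inl (.inl ⟨φ, hφ, hc⟩)
  · have := Finset.mem_singleton.1 (formulaConsts_renaming _ _ _ hc)
    subst this
    exact hx
  · exact .inl (.inr hc)
  · exact .inr ⟨g, hg, hc⟩
  · exact absurd hc (Finset.notMem_empty c)

theorem eqFree_renaming (q : L.Relations 0) (l : UnaryLit L) (c : L.Constants) :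
    EqFree ((PropLit.form ⟨true, q⟩ : L.BoundedFormula Empty 0).imp (UnaryLit.at l c.term)) := by
  unfold PropLit.form UnaryLit.at
  cases l.sign <;>
    simp [EqFree, Relations.boundedFormula, Relations.boundedFormula₁, BoundedFormula.not]

theorem hasSuccessfulDerivation_flooded (hL : ∀ n : ℕ, IsEmpty (L.Functions (n + 1)))
    {P : TemporalProblem L} (hP : P.IsDSNF) (hunsat : ¬ P.Satisfiable) :
    HasSuccessfulDerivation P.flooded := by
  classical
  by_contra hno
  refine hunsat (Satisfiable.of_subset (Q := P.flooded) (satisfiable_of_not_hasSuccessfulDerivation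
    hL hP.eqFree_univ hP.eqFree_init (fun l hl c hc => ?_) hno) subset_rfl subset_rfl subset_rfl
    subset_rfl Finset.subset_union_left subset_rfl)
  exact ⟨.const l c, Finset.mem_union_right _ (Finset.mem_image.2
    ⟨(l, c), Finset.mem_product.2 ⟨hl, consts_flooded P hc⟩, rfl⟩), fun _ h => h⟩

theorem hasSuccessfulDerivation_floodedRenamed (hL : ∀ n : ℕ, IsEmpty (L.Functions (n + 1)))
    {P : TemporalProblem L} (hP : P.IsDSNF) (hunsat : ¬ P.Satisfiable)
    (name : UnaryLit L → L.Constants → L.Relations 0) :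
    HasSuccessfulDerivation (P.floodedRenamed name) := by
  classical
  by_contra hno
  refine hunsat (Satisfiable.of_subset (Q := P.floodedRenamed name)
    (satisfiable_of_not_hasSuccessfulDerivation hL (fun φ hφ => ?_) hP.eqFree_init
      (fun l hl c hc => ?_) hno) subset_rfl Finset.subset_union_left subset_rfl subset_rfl
    Finset.subset_union_left subset_rfl)
  · rcases Finset.mem_union.1 hφ with hφ | hφ
    · exact hP.eqFree_univ φ hφ
    · obtain ⟨x, -, rfl⟩ := Finset.mem_image.1 hφ
      exact eqFree_renaming _ _ _
  · have hmem : (l, c) ∈ P.evUnary ×ˢ P.consts :=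
      Finset.mem_product.2 ⟨hl, consts_floodedRenamed P name hc⟩
    refine ⟨.prop ⟨true, name l c⟩,
      Finset.mem_union_right _ (Finset.mem_image.2 ⟨(l, c), hmem, rfl⟩), fun A h => ?_⟩
    -- The renaming implication lies in the saturation, so in each of its models the truth of the
    -- proposition forces `L(c)`; no freshness of the name is needed.
    have hA := realize_of_mem A (univ_subset_saturation _
      (Finset.mem_coe.2 (Finset.mem_union_right _ (Finset.mem_image.2 ⟨(l, c), hmem, rfl⟩))))
    rw [BoundedFormula.realize_imp, PropLit.realize_form, UnaryLit.realize_at_const] at hA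
    exact hA h

end TemporalProblem

end TemporalModels

end MonodicFOTL

theorem mainTheorem1 (L : FirstOrder.Language.{0, 0}) (hL : ∀ n : ℕ, IsEmpty (L.Functions (n + 1)))
    (P : MonodicFOTL.TemporalProblem L) (hP : P.IsDSNF) (hunsat : ¬ P.Satisfiable) :
    MonodicFOTL.HasSuccessfulDerivation P.flooded ∧
      ∀ name : MonodicFOTL.UnaryLit L → L.Constants → L.Relations 0,
        MonodicFOTL.HasSuccessfulDerivation (P.floodedRenamed name) :=
  ⟨MonodicFOTL.TemporalProblem.hasSuccessfulDerivation_flooded hL hP hunsat,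
    MonodicFOTL.TemporalProblem.hasSuccessfulDerivation_floodedRenamed hL hP hunsat⟩
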